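/- Let $p\in\mathbb C[x]$ be a nonzero polynomial of degree $n$ and let $c\in\mathbb C$ be such that $p(x)=(-1)^n p(-x+c)$. Let $\mathcal D^a$ be the associative algebra of differential operators $\sum_k t^k f_k(D)$ on $\mathbb C[t,t^{-1}]$ (finite sums, $k\in\mathbb Z$, $f_k\in\mathbb C[x]$, $D=t\frac{d}{dt}$), and let $\widehat{\mathcal D}=\mathcal D\oplus\mathbb C C$ be the central extension of the corresponding Lie algebra $\mathcal D$ by the antisymmetric 2-cocycle $$\Psi(t^rf(D),t^sg(D))=\sum_{-r\le m\le -1}f(m)g(m+r)\ \text{ if } r=-s>0,\qquad \Psi(t^rf(D),t^sg(D))=0\ \text{ if } r+s\ne0 \text{ or } r=s=0.$$ For each choice of sign let $\sigma_\pm$ be the anti-involution $\sigma_\pm(t^kf(D)p(D))=(-1)^n(\pm t)^kf(-D-k+c)p(D)$ of $\mathcal D^a p(D)$, let $\mathcal D_p^\pm=\{d\in\mathcal D^a p(D):\sigma_\pm(d)=-d\}$, a Lie subalgebra of $\mathcal D$, and let $\widehat{\mathcal D}_p^\pm=\mathcal D_p^\pm\oplus\mathbb C C\subset\widehat{\mathcal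 D}$, with the $\mathbb Z$-gradation in which $t^kf(D)p(D)$ has degree $k$ and $C$ has degree $0$. Let $\lambda$ be a linear functional on $(\widehat{\mathcal D}_p^\pm)_0$ and let $L(\widehat{\mathcal D}_p^\pm,\lambda)$ be the irreducible highest weight module, i.e. the quotient of the Verma module of highest weight $\lambda$ by its maximal proper graded submodule. It is called quasifinite if all its homogeneous components are finite-dimensional. Put $\Delta_l=-\lambda\big((D-\tfrac c2)^l\,p(D)\big)$ for the integers $l\ge0$ with $l+n$ odd, and let $\Delta_\lambda(x)=\sum_l \Delta_l\,\frac{x^l}{l!}$, the sum over these $l$, as a formal power series. Then $L(\widehat{\mathcal D}_p^{\pm},\lambda)$ is quasifinite if and only if there is an even quasipolynomial $\phi_\lambda$ (an even linear combination of functions $q(x)e^{\alpha x}$ with $q\in\mathbb C[x]$, $\alpha\in\mathbb C$) with $\phi_\lambda(0)=0$ such that $$\Delta_\lambda(x)=p\Big(\frac{d}{dx}+\frac c2\Big)\left(\frac{\phi_\lambda(x)}{2\sinh(x/2)}\right).$$ -/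

import Mathlib

open Polynomial

namespace CircleOp

/-! ### The associative algebra of regular differential operators on the circle -/

/-- Regular differential operators on the circle in normal form: the finitely supported family
`(f k)` stands for the operator `∑ k, t ^ k * (f k) (D)`, where `D = t * d/dt`. -/
def DiffOp : Type := ℤ →₀ ℂ[X]

noncomputable instance : AddCommGroup DiffOp := inferInstanceAs (AddCommGroup (ℤ →₀ ℂ[X]))

noncomputable instance : Module ℂ DiffOp := inferInstanceAs (Module ℂ (ℤ →₀ ℂ[X]))

/-- `mon k f` is the operator `t ^ k f(D)`. -/
noncomputable def mon (k : ℤ) : ℂ[X] →ₗ[ℂ] DiffOp := Finsupp.lsingle k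

theorem induction_mon {P : DiffOp → Prop} (a : DiffOp) (h0 : P 0)
    (hadd : ∀ a b, P a → P b → P (a + b)) (hmon : ∀ k f, P (mon k f)) : P a :=
  Finsupp.induction_linear a h0 hadd hmon

/-- The linear map on operators that takes the value `F k f` on `t ^ k f(D)`. -/
noncomputable def lift {V : Type*} [AddCommGroup V] [Module ℂ V] (F : ℤ → ℂ[X] →ₗ[ℂ] V) :
    DiffOp →ₗ[ℂ] V := Finsupp.lsum ℂ F

theorem lift_mon {V : Type*} [AddCommGroup V] [Module ℂ V] (F : ℤ → ℂ[X] →ₗ[ℂ] V) (k : ℤ)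
    (f : ℂ[X]) : lift F (mon k f) = F k f :=
  Finsupp.lsum_single ℂ F k f

/-- The bilinear map on operators that takes the value `B r s f g` on `t ^ r f(D)`,
`t ^ s g(D)`. -/
noncomputable def bilin {V : Type*} [AddCommGroup V] [Module ℂ V]
    (B : ℤ → ℤ → ℂ[X] →ₗ[ℂ] ℂ[X] →ₗ[ℂ] V) : DiffOp →ₗ[ℂ] DiffOp →ₗ[ℂ] V :=
  lift fun r => LinearMap.flip (lift fun s => LinearMap.flip (B r s))

theorem bilin_mon {V : Type*} [AddCommGroup V] [Module ℂ V]
    (B : ℤ → ℤ → ℂ[X] →ₗ[ℂ] ℂ[X] →ₗ[ℂ] V) (r s : ℤ) (f g : ℂ[X]) :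
    bilin B (mon r f) (mon s g) = B r s f g := by
  rw [bilin, lift_mon, LinearMap.flip_apply, lift_mon, LinearMap.flip_apply]

/-- Composition of operators, determined by `f(D) t ^ s = t ^ s f(D + s)`. -/
noncomputable def mulBilin : DiffOp →ₗ[ℂ] DiffOp →ₗ[ℂ] DiffOp :=
  bilin fun r s =>
    ((LinearMap.mul ℂ ℂ[X]).comp (taylor (s : ℂ))).compr₂ (mon (r + s))

noncomputable instance : Mul DiffOp := ⟨fun a b => mulBilin a b⟩

noncomputable instance : One DiffOp := ⟨mon 0 1⟩

theorem mul_def (a b : DiffOp) : a * b = mulBilin a b := rfl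

theorem one_def : (1 : DiffOp) = mon 0 1 := rfl

/-- `t ^ r f(D) * t ^ s g(D) = t ^ (r + s) f(D + s) g(D)`. -/
theorem mon_mul_mon (r s : ℤ) (f g : ℂ[X]) :
    mon r f * mon s g = mon (r + s) (f.comp (X + C (s : ℂ)) * g) := by
  rw [mul_def, mulBilin, bilin_mon]
  rfl

private theorem left_distrib' (a b c : DiffOp) : a * (b + c) = a * b + a * c := by
  simp only [mul_def, map_add]

private theorem right_distrib' (a b c : DiffOp) : (a + b) * c = a * c + b * c := by
  simp only [mul_def, map_add, LinearMap.add_apply]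

private theorem zero_mul' (a : DiffOp) : 0 * a = 0 := by
  simp only [mul_def, map_zero, LinearMap.zero_apply]

private theorem mul_zero' (a : DiffOp) : a * 0 = 0 := by
  simp only [mul_def, map_zero]

private theorem mul_assoc' (a b c : DiffOp) : a * b * c = a * (b * c) := by
  induction a using induction_mon with
  | h0 => simp only [zero_mul']
  | hadd a a' h h' => simp only [right_distrib', h, h']
  | hmon r f =>
    induction b using induction_mon with
    | h0 => simp only [zero_mul', mul_zero']
    | hadd b b' h h' => simp only [right_distrib', left_distrib', h, h']
    | hmon s g =>
      induction c using induction_mon with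
      | h0 => simp only [mul_zero']
      | hadd c c' h h' => simp only [left_distrib', h, h']
      | hmon u h =>
        simp only [mon_mul_mon, mul_comp, comp_assoc, add_comp, X_comp, C_comp, Int.cast_add,
          C_add, add_assoc, mul_assoc, add_comm (C (u : ℂ)) (C (s : ℂ))]

noncomputable instance : Ring DiffOp where
  __ := (inferInstance : AddCommGroup DiffOp)
  left_distrib := left_distrib'
  right_distrib := right_distrib'
  zero_mul := zero_mul'
  mul_zero := mul_zero'
  mul_assoc := mul_assoc'
  one_mul a := by
    induction a using induction_mon with
    | h0 => exact mul_zero' _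
    | hadd a b h h' => rw [left_distrib', h, h']
    | hmon k f => rw [one_def, mon_mul_mon, one_comp, one_mul, zero_add]
  mul_one a := by
    induction a using induction_mon with
    | h0 => exact zero_mul' _
    | hadd a b h h' => rw [right_distrib', h, h']
    | hmon k f => rw [one_def, mon_mul_mon]; simp

noncomputable instance : Algebra ℂ DiffOp :=
  Algebra.ofModule
    (fun z a b => by simp only [mul_def, map_smul, LinearMap.smul_apply])
    (fun z a b => by simp only [mul_def, map_smul])

/-- The Lie algebra `𝒟` of differential operators, with the commutator bracket. -/
noncomputable instance : LieRing DiffOp := LieRing.ofAssociativeRing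

noncomputable instance : LieAlgebra ℂ DiffOp := LieAlgebra.ofAssociativeAlgebra

theorem lie_def (a b : DiffOp) : ⁅a, b⁆ = a * b - b * a := rfl

/-! ### The central extension -/

/-- The value of the cocycle on `t ^ r f(D)`, `t ^ s g(D)`: it is
`∑ m ∈ {-r, …, -1}, f(m) g(m + r)` if `r = -s > 0`, it vanishes if `r + s ≠ 0` or `r = s = 0`, and
it is extended to `r = -s < 0` by antisymmetry. -/
noncomputable def psiMon (r s : ℤ) : ℂ[X] →ₗ[ℂ] ℂ[X] →ₗ[ℂ] ℂ :=
  LinearMap.mk₂ ℂ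
    (fun f g => if r + s = 0 then
        (∑ m ∈ Finset.Ico (-r) 0, f.eval (m : ℂ) * g.eval ((m + r : ℤ) : ℂ))
        - ∑ m ∈ Finset.Ico (-s) 0, g.eval (m : ℂ) * f.eval ((m + s : ℤ) : ℂ)
      else 0)
    (fun f f' g => by
      split_ifs
      · simp only [eval_add, add_mul, mul_add, Finset.sum_add_distrib]; ring
      · simp)
    (fun z f g => by
      split_ifs
      · simp only [eval_smul, smul_eq_mul, mul_sub, Finset.mul_sum]
        congr 1 <;> exact Finset.sum_congr rfl fun m _ => by ring
      · simp)
    (fun f g g' => by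
      split_ifs
      · simp only [eval_add, add_mul, mul_add, Finset.sum_add_distrib]; ring
      · simp)
    (fun z f g => by
      split_ifs
      · simp only [eval_smul, smul_eq_mul, mul_sub, Finset.mul_sum]
        congr 1 <;> exact Finset.sum_congr rfl fun m _ => by ring
      · simp)

/-- The 2-cocycle `Ψ` on `𝒟`. -/
noncomputable def psi : DiffOp →ₗ[ℂ] DiffOp →ₗ[ℂ] ℂ := bilin psiMon

theorem psi_mon (r s : ℤ) (f g : ℂ[X]) :
    psi (mon r f) (mon s g) = if r + s = 0 then
        (∑ m ∈ Finset.Ico (-r) 0, f.eval (m : ℂ) * g.eval ((m + r : ℤ) : ℂ))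
        - ∑ m ∈ Finset.Ico (-s) 0, g.eval (m : ℂ) * f.eval ((m + s : ℤ) : ℂ)
      else 0 := by
  rw [psi, bilin_mon]; rfl

theorem psi_antisymm (a b : DiffOp) : psi a b = -psi b a := by
  induction a using induction_mon with
  | h0 => simp
  | hadd a a' h h' => simp only [map_add, LinearMap.add_apply, h, h']; ring
  | hmon r f =>
    induction b using induction_mon with
    | h0 => simp
    | hadd b b' h h' => simp only [map_add, LinearMap.add_apply, h, h']; ring
    | hmon s g =>
      rw [psi_mon, psi_mon, add_comm s r]
      split_ifs <;> ring

theorem psi_self (a : DiffOp) : psi a a = 0 := by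
  have h := psi_antisymm a a
  linear_combination h / 2

private theorem sum_Ico_succ_right (F : ℤ → ℂ) (a b : ℤ) (h : a ≤ b) :
    ∑ m ∈ Finset.Ico a (b + 1), F m = ∑ m ∈ Finset.Ico a b, F m + F b := by
  have : Finset.Ico a (b + 1) = insert b (Finset.Ico a b) := by ext x; simp; omega
  rw [this, Finset.sum_insert (by simp)]
  ring

private theorem sum_Ico_succ_left (F : ℤ → ℂ) (a b : ℤ) (h : a < b) :
    ∑ m ∈ Finset.Ico a b, F m = F a + ∑ m ∈ Finset.Ico (a + 1) b, F m := by
  have : Finset.Ico a b = insert a (Finset.Ico (a + 1) b) := by ext x; simp; omega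
  rw [this, Finset.sum_insert (by simp)]

private theorem sum_tele_le (F Q : ℤ → ℂ) (hQ : ∀ m, Q (m + 1) - Q m = F m) (a b : ℤ)
    (hab : a ≤ b) : ∑ m ∈ Finset.Ico a b, F m = Q b - Q a := by
  induction b, hab using Int.leInduction with
  | base => simp
  | succ b hb ih =>
    rw [sum_Ico_succ_right F a b hb, ih, ← hQ b]
    ring

private theorem sum_tele (F Q : ℤ → ℂ) (hQ : ∀ m, Q (m + 1) - Q m = F m) (a b : ℤ) :
    (∑ m ∈ Finset.Ico a b, F m) - ∑ m ∈ Finset.Ico b a, F m = Q b - Q a := by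
  rcases le_total a b with h | h
  · rw [sum_tele_le F Q hQ a b h, Finset.Ico_eq_empty (by omega : ¬ b < a)]; simp
  · rw [sum_tele_le F Q hQ b a h, Finset.Ico_eq_empty (by omega : ¬ a < b)]; simp

private theorem exists_primitive (F : ℤ → ℂ) : ∃ Q : ℤ → ℂ, ∀ m, Q (m + 1) - Q m = F m := by
  refine ⟨fun m => (∑ k ∈ Finset.Ico 0 m, F k) - ∑ k ∈ Finset.Ico m 0, F k, fun m => ?_⟩
  beta_reduce
  rcases le_or_gt 0 m with h | h
  · rw [sum_Ico_succ_right F 0 m h, Finset.Ico_eq_empty (by omega : ¬ m < 0),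
      Finset.Ico_eq_empty (by omega : ¬ m + 1 < 0)]
    simp
  · rw [sum_Ico_succ_left F m 0 h, Finset.Ico_eq_empty (by omega : ¬ 0 < m),
      Finset.Ico_eq_empty (by omega : ¬ 0 < m + 1)]
    simp

private theorem psi_mon_eq (r s : ℤ) (hrs : r + s = 0) (f g : ℂ[X]) (Q : ℤ → ℂ)
    (hQ : ∀ m : ℤ, Q (m + 1) - Q m = f.eval (m : ℂ) * g.eval ((m + r : ℤ) : ℂ)) :
    psi (mon r f) (mon s g) = Q 0 - Q (-r) := by
  obtain rfl : s = -r := by omega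
  rw [psi_mon, if_pos hrs, ← sum_tele _ Q hQ]
  congr 1
  refine Finset.sum_bij' (fun m _ => m - r) (fun m _ => m + r) ?_ ?_ ?_ ?_ ?_
  · intro m hm; simp at hm ⊢; omega
  · intro m hm; simp at hm ⊢; omega
  · intro m hm; ring
  · intro m hm; ring
  · intro m hm
    rw [show m - r + r = m by ring, show m + -r = m - r by ring]; ring

private theorem psi_cyclic_mon (r s u : ℤ) (f g h : ℂ[X]) :
    psi (mon r f * mon s g) (mon u h) + psi (mon s g * mon u h) (mon r f)
      + psi (mon u h * mon r f) (mon s g) = 0 := by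
  simp only [mon_mul_mon]
  by_cases hz : r + s + u = 0
  · obtain ⟨Q, hQ⟩ := exists_primitive fun m =>
      f.eval ((m + s : ℤ) : ℂ) * g.eval (m : ℂ) * h.eval ((m + r + s : ℤ) : ℂ)
    rw [psi_mon_eq (r + s) u hz _ _ Q, psi_mon_eq (s + u) r (by omega) _ _ (fun m => Q (m + u)),
      psi_mon_eq (u + r) s (by omega) _ _ (fun m => Q (m - s))]
    · rw [show -(r + s) = u by omega, show -(s + u) + u = -s by omega,
        show -(u + r) - s = 0 by omega, zero_add, zero_sub]
      ring
    · intro m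
      rw [show m + 1 - s = m - s + 1 by ring, hQ]
      obtain rfl : u = -r - s := by omega
      simp only [eval_mul, eval_comp, eval_add, eval_X, eval_C]
      push_cast
      ring_nf
    · intro m
      rw [show m + 1 + u = m + u + 1 by ring, hQ]
      obtain rfl : u = -r - s := by omega
      simp only [eval_mul, eval_comp, eval_add, eval_X, eval_C]
      push_cast
      ring_nf
    · intro m
      rw [hQ]
      simp only [eval_mul, eval_comp, eval_add, eval_X, eval_C]
      push_cast
      ring_nf
  · rw [psi_mon, psi_mon, psi_mon, if_neg hz, if_neg (by omega), if_neg (by omega)]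
    simp

private theorem psi_cyclic (a b c : DiffOp) :
    psi (a * b) c + psi (b * c) a + psi (c * a) b = 0 := by
  induction a using induction_mon with
  | h0 => simp
  | hadd a a' h h' =>
    simp only [add_mul, mul_add, map_add, LinearMap.add_apply]; linear_combination h + h'
  | hmon r f =>
    induction b using induction_mon with
    | h0 => simp
    | hadd a a' h h' =>
      simp only [add_mul, mul_add, map_add, LinearMap.add_apply]; linear_combination h + h'
    | hmon s g =>
      induction c using induction_mon with
      | h0 => simp
      | hadd a a' h h' =>
        simp only [add_mul, mul_add, map_add, LinearMap.add_apply]; linear_combination h + h'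
      | hmon u h => exact psi_cyclic_mon r s u f g h

theorem psi_cocycle (a b c : DiffOp) :
    psi ⁅a, b⁆ c + psi ⁅b, c⁆ a + psi ⁅c, a⁆ b = 0 := by
  simp only [lie_def, map_sub, LinearMap.sub_apply]
  linear_combination psi_cyclic a b c - psi_cyclic b a c

/-- The central extension `𝒟 + ℂ C`; the pair `(a, z)` stands for `a + z C`. -/
def DHat : Type := DiffOp × ℂ

noncomputable instance : AddCommGroup DHat := inferInstanceAs (AddCommGroup (DiffOp × ℂ))

noncomputable instance : Module ℂ DHat := inferInstanceAs (Module ℂ (DiffOp × ℂ))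

/-- `[a + z C, b + w C] = [a, b] + Ψ(a, b) C`. -/
noncomputable instance : Bracket DHat DHat := ⟨fun x y => (⁅x.1, y.1⁆, psi x.1 y.1)⟩

theorem DHat.lie_def (x y : DHat) : ⁅x, y⁆ = (⁅x.1, y.1⁆, psi x.1 y.1) := rfl

noncomputable instance : LieRing DHat where
  add_lie x y z := by
    refine Prod.ext ?_ ?_
    · exact add_lie x.1 y.1 z.1
    · exact LinearMap.map_add₂ psi x.1 y.1 z.1
  lie_add x y z := by
    refine Prod.ext ?_ ?_
    · exact lie_add x.1 y.1 z.1
    · exact map_add (psi x.1) y.1 z.1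
  lie_self x := by
    refine Prod.ext ?_ ?_
    · exact lie_self x.1
    · exact psi_self x.1
  leibniz_lie x y z := by
    refine Prod.ext ?_ ?_
    · exact leibniz_lie x.1 y.1 z.1
    · change psi x.1 ⁅y.1, z.1⁆ = psi ⁅x.1, y.1⁆ z.1 + psi y.1 ⁅x.1, z.1⁆
      have h := psi_cocycle x.1 y.1 z.1
      have h1 := psi_antisymm x.1 ⁅y.1, z.1⁆
      have h2 := psi_antisymm y.1 ⁅x.1, z.1⁆
      have h3 : psi ⁅z.1, x.1⁆ y.1 = -psi ⁅x.1, z.1⁆ y.1 := by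
        rw [← lie_skew, map_neg, LinearMap.neg_apply]
      linear_combination h1 - h2 + h3 - h

noncomputable instance : LieAlgebra ℂ DHat where
  lie_smul z x y := by
    refine Prod.ext ?_ ?_
    · exact lie_smul z x.1 y.1
    · exact map_smul (psi x.1) z y.1

/-- The projection of the central extension onto `𝒟`. -/
noncomputable def proj : DHat →ₗ⁅ℂ⁆ DiffOp where
  toFun x := x.1
  map_add' _ _ := rfl
  map_smul' _ _ := rfl
  map_lie' := rfl

/-- The homogeneous component of degree `k` of the central extension, where `t ^ k f(D)` has
degree `k` and `C` has degree `0`. -/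
noncomputable def hatGrade (k : ℤ) : Submodule ℂ DHat where
  carrier := {x | (∃ f : ℂ[X], x.1 = mon k f) ∧ (k ≠ 0 → x.2 = 0)}
  add_mem' := by
    rintro x y ⟨⟨f, hf⟩, hx⟩ ⟨⟨g, hg⟩, hy⟩
    refine ⟨⟨f + g, ?_⟩, fun hk => ?_⟩
    · rw [map_add, ← hf, ← hg]; rfl
    · change x.2 + y.2 = 0
      rw [hx hk, hy hk, add_zero]
  zero_mem' := ⟨⟨0, by rw [map_zero]; rfl⟩, fun _ => rfl⟩
  smul_mem' := by
    rintro z x ⟨⟨f, hf⟩, hx⟩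
    refine ⟨⟨z • f, ?_⟩, fun hk => ?_⟩
    · rw [map_smul, ← hf]; rfl
    · change z • x.2 = 0
      rw [hx hk, smul_zero]

/-! ### The subalgebras fixed by minus an anti-involution -/

/-- The condition `p(x) = (-1) ^ deg p * p(-x + c)`. -/
def IsSymmetricAbout (p : ℂ[X]) (c : ℂ) : Prop :=
  p = (-1) ^ p.natDegree * p.comp (-X + C c)

/-- The linear map `t ^ k f(D) ↦ (-1) ^ deg p * (± t) ^ k f(-D - k + c)`, the sign being `s`. -/
noncomputable def sigmaZero (p : ℂ[X]) (c : ℂ) (s : ℤˣ) : DiffOp →ₗ[ℂ] DiffOp :=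
  lift fun k : ℤ =>
    ((-1) ^ p.natDegree * (((s ^ k : ℤˣ) : ℤ) : ℂ)) •
      (mon k).comp (aeval (-X - C (k : ℂ) + C c) : ℂ[X] →ₐ[ℂ] ℂ[X]).toLinearMap

theorem sigmaZero_mon (p : ℂ[X]) (c : ℂ) (s : ℤˣ) (k : ℤ) (f : ℂ[X]) :
    sigmaZero p c s (mon k f) = ((-1) ^ p.natDegree * (((s ^ k : ℤˣ) : ℤ) : ℂ)) •
      mon k (f.comp (-X - C (k : ℂ) + C c)) := by
  rw [sigmaZero, lift_mon]
  rfl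

private theorem sigmaZero_mon' (p : ℂ[X]) (c : ℂ) (s : ℤˣ) (k : ℤ) (f : ℂ[X]) :
    sigmaZero p c s (mon k f) = mon k (C ((-1) ^ p.natDegree * (((s ^ k : ℤˣ) : ℤ) : ℂ)) *
      f.comp (-X - C (k : ℂ) + C c)) := by
  rw [sigmaZero_mon, ← map_smul, smul_eq_C_mul]

private theorem sigmaZero_mul (p : ℂ[X]) (c : ℂ) (s : ℤˣ) (hc : IsSymmetricAbout p c)
    (a b : DiffOp) : sigmaZero p c s (a * mon 0 p * b) =
      sigmaZero p c s b * mon 0 p * sigmaZero p c s a := by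
  induction a using induction_mon with
  | h0 => simp
  | hadd a a' h h' => simp only [add_mul, mul_add, map_add, h, h']
  | hmon r f =>
    induction b using induction_mon with
    | h0 => simp
    | hadd b b' h h' => simp only [add_mul, mul_add, map_add, h, h']
    | hmon u g =>
      have hs : (((s ^ (r + u) : ℤˣ) : ℤ) : ℂ) =
          (((s ^ r : ℤˣ) : ℤ) : ℂ) * (((s ^ u : ℤˣ) : ℤ) : ℂ) := by
        rw [zpow_add]; push_cast; ring
      have he : p.comp (X + C (r : ℂ)) =
          (-1) ^ p.natDegree * p.comp (-X - C (r : ℂ) + C c) := by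
        conv_lhs => rw [show p = (-1) ^ p.natDegree * p.comp (-X + C c) from hc]
        simp only [mul_comp, pow_comp, neg_comp, one_comp, comp_assoc, add_comp, X_comp, C_comp]
        congr 2
        ring
      have h1 : ((mon r f * mon 0 p) * mon u g) =
          mon (r + u) (f.comp (X + C (u : ℂ)) * p.comp (X + C (u : ℂ)) * g) := by
        rw [mon_mul_mon, mon_mul_mon]; simp
      have h2 (z w : ℂ) : mon u (C z * g.comp (-X - C (u : ℂ) + C c)) * mon 0 p *
          mon r (C w * f.comp (-X - C (r : ℂ) + C c)) =
          mon (r + u) (C z * g.comp (-X - C ((r + u : ℤ) : ℂ) + C c) * p.comp (X + C (r : ℂ)) *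
            (C w * f.comp (-X - C (r : ℂ) + C c))) := by
        have : (-(X + C (r : ℂ)) - C (u : ℂ) + C c : ℂ[X]) = -X - C ((r + u : ℤ) : ℂ) + C c := by
          rw [Int.cast_add, C_add]; ring
        rw [mon_mul_mon, mon_mul_mon, add_zero, add_comm u r, Int.cast_zero, C_0, add_zero, comp_X]
        simp only [mul_comp, comp_assoc, add_comp, sub_comp, neg_comp, X_comp, C_comp, this]
      have h3 : ((f.comp (X + C (u : ℂ)) * p.comp (X + C (u : ℂ)) * g).comp
          (-X - C ((r + u : ℤ) : ℂ) + C c)) =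
          f.comp (-X - C (r : ℂ) + C c) * p.comp (-X - C (r : ℂ) + C c) *
            g.comp (-X - C ((r + u : ℤ) : ℂ) + C c) := by
        have : (-X - C ((r + u : ℤ) : ℂ) + C c + C (u : ℂ) : ℂ[X]) = -X - C (r : ℂ) + C c := by
          rw [Int.cast_add, C_add]; ring
        simp only [mul_comp, comp_assoc, add_comp, X_comp, C_comp, this]
      rw [h1, sigmaZero_mon', sigmaZero_mon', sigmaZero_mon', h2, h3, he, hs]
      congr 1
      generalize f.comp _ = f'
      generalize g.comp _ = g'
      generalize p.comp _ = p'
      have hsq : ((-1 : ℂ[X]) ^ p.natDegree) * (-1) ^ p.natDegree = 1 := by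
        rw [← mul_pow]; simp
      simp only [C_mul, C_pow, C_neg, C_1]
      generalize (-1 : ℂ[X]) ^ p.natDegree = e at hsq
      linear_combination (-(e * C (((s ^ r : ℤˣ) : ℤ) : ℂ) * C (((s ^ u : ℤˣ) : ℤ) : ℂ)
        * f' * g' * p')) * hsq

/-- The Lie algebra `𝒟_p^±`: the elements `d = a p(D)` of `𝒟_p` with `σ(d) = -d`, where
`σ(a p(D)) = σ₀(a) p(D)`. -/
noncomputable def DpSub (p : ℂ[X]) (c : ℂ) (s : ℤˣ) (hc : IsSymmetricAbout p c) :
    LieSubalgebra ℂ DiffOp where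
  carrier := {d | ∃ a : DiffOp, d = a * mon 0 p ∧ sigmaZero p c s a * mon 0 p = -d}
  add_mem' := by
    rintro _ _ ⟨a, rfl, ha⟩ ⟨b, rfl, hb⟩
    exact ⟨a + b, by rw [add_mul], by rw [map_add, add_mul, ha, hb, neg_add]⟩
  zero_mem' := ⟨0, by simp, by simp⟩
  smul_mem' := by
    rintro z _ ⟨a, rfl, ha⟩
    exact ⟨z • a, by rw [smul_mul_assoc], by rw [map_smul, smul_mul_assoc, ha, smul_neg]⟩
  lie_mem' := by
    rintro _ _ ⟨a, rfl, ha⟩ ⟨b, rfl, hb⟩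
    refine ⟨a * mon 0 p * b - b * mon 0 p * a, ?_, ?_⟩
    · rw [lie_def]; noncomm_ring
    · rw [map_sub, sigmaZero_mul p c s hc, sigmaZero_mul p c s hc, sub_mul,
        mul_assoc _ (sigmaZero p c s a), ha, mul_assoc _ (sigmaZero p c s b), hb, lie_def]
      noncomm_ring

/-- The central extension of `𝒟_p^±` by `ℂ C` given by the restriction of `Ψ`. -/
noncomputable def DpHat (p : ℂ[X]) (c : ℂ) (s : ℤˣ) (hc : IsSymmetricAbout p c) :
    LieSubalgebra ℂ DHat :=
  (DpSub p c s hc).comap proj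

/-- The principal gradation of the central extension of `𝒟_p^±`. -/
noncomputable def grading (p : ℂ[X]) (c : ℂ) (s : ℤˣ) (hc : IsSymmetricAbout p c) (k : ℤ) :
    Submodule ℂ (DpHat p c s hc) :=
  (hatGrade k).comap (DpHat p c s hc).toSubmodule.subtype

/-! ### Highest weight modules of a graded Lie algebra -/

section HighestWeight

variable {L : Type*} [LieRing L] [LieAlgebra ℂ L]

attribute [local instance] LieRing.ofAssociativeRing

/-- The left ideal generated by `L_j` for `j > 0` and by `h - lam(h)` for `h ∈ L_0`. -/
noncomputable def vermaIdeal (gr : ℤ → Submodule ℂ L) (lam : Module.Dual ℂ (gr 0)) :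
    Submodule (UniversalEnvelopingAlgebra ℂ L) (UniversalEnvelopingAlgebra ℂ L) :=
  Submodule.span (UniversalEnvelopingAlgebra ℂ L)
    ({u | ∃ j : ℤ, 0 < j ∧ ∃ x ∈ gr j, u = UniversalEnvelopingAlgebra.ι ℂ x} ∪
      {u | ∃ h : gr 0, u = UniversalEnvelopingAlgebra.ι ℂ (h : L) -
        algebraMap ℂ (UniversalEnvelopingAlgebra ℂ L) (lam h)})

/-- The Verma module `M(L, lam)`: the tensor product over `U(L_0 ⊕ L_+)` of `U(L)` with the
one-dimensional module given by `lam`, which is the quotient of `U(L)` by `vermaIdeal`. A module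
over `L` is here a module over `U(L)`. -/
abbrev Verma (gr : ℤ → Submodule ℂ L) (lam : Module.Dual ℂ (gr 0)) : Type _ :=
  UniversalEnvelopingAlgebra ℂ L ⧸ vermaIdeal gr lam

/-- The products `x₁ ⋯ xₙ` in `U(L)` of homogeneous elements of degrees adding up to the given
integer. -/
inductive IsMonomial (gr : ℤ → Submodule ℂ L) : ℤ → UniversalEnvelopingAlgebra ℂ L → Prop
  | one : IsMonomial gr 0 1
  | mul {i j : ℤ} {x : L} {u : UniversalEnvelopingAlgebra ℂ L} :
      x ∈ gr i → IsMonomial gr j u →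
        IsMonomial gr (i + j) (UniversalEnvelopingAlgebra.ι ℂ x * u)

/-- The component of degree `j` of `U(L)`. -/
noncomputable def envelopingGrade (gr : ℤ → Submodule ℂ L) (j : ℤ) :
    Submodule ℂ (UniversalEnvelopingAlgebra ℂ L) :=
  Submodule.span ℂ {u | IsMonomial gr j u}

/-- The component of degree `j` of the Verma module, whose highest weight vector has degree `0`. -/
noncomputable def vermaGrade (gr : ℤ → Submodule ℂ L) (lam : Module.Dual ℂ (gr 0)) (j : ℤ) :
    Submodule ℂ (Verma gr lam) :=
  (envelopingGrade gr j).map ((vermaIdeal gr lam).mkQ.restrictScalars ℂ)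

/-- A submodule `N` of the Verma module is graded if it is the sum of its homogeneous components
`N ∩ M_j`. -/
def IsGradedSubmodule (gr : ℤ → Submodule ℂ L) (lam : Module.Dual ℂ (gr 0))
    (N : Submodule (UniversalEnvelopingAlgebra ℂ L) (Verma gr lam)) : Prop :=
  N.restrictScalars ℂ = ⨆ j : ℤ, N.restrictScalars ℂ ⊓ vermaGrade gr lam j

/-- The maximal proper graded submodule of the Verma module, as the sum of all proper graded
submodules. -/
noncomputable def maxGradedSubmodule (gr : ℤ → Submodule ℂ L) (lam : Module.Dual ℂ (gr 0)) :
    Submodule (UniversalEnvelopingAlgebra ℂ L) (Verma gr lam) :=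
  sSup {N | IsGradedSubmodule gr lam N ∧ N ≠ ⊤}

/-- The irreducible highest weight module `L(L, lam)`. -/
abbrev Irred (gr : ℤ → Submodule ℂ L) (lam : Module.Dual ℂ (gr 0)) : Type _ :=
  Verma gr lam ⧸ maxGradedSubmodule gr lam

/-- The component of degree `j` of the irreducible highest weight module. -/
noncomputable def irredGrade (gr : ℤ → Submodule ℂ L) (lam : Module.Dual ℂ (gr 0)) (j : ℤ) :
    Submodule ℂ (Irred gr lam) :=
  (vermaGrade gr lam j).map ((maxGradedSubmodule gr lam).mkQ.restrictScalars ℂ)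

/-- All homogeneous components of the irreducible highest weight module are finite-dimensional. -/
def IsQuasifinite (gr : ℤ → Submodule ℂ L) (lam : Module.Dual ℂ (gr 0)) : Prop :=
  ∀ j : ℤ, FiniteDimensional ℂ (irredGrade gr lam j)

end HighestWeight

/-! ### Labels and generating series -/

/-- `(D - c/2) ^ l p(D)`, as an element of the central extension of `𝒟`. -/
noncomputable def labelOp (p : ℂ[X]) (c : ℂ) (l : ℕ) : DHat :=
  (mon 0 ((X - C (c / 2)) ^ l * p), 0)

theorem labelOp_mem (p : ℂ[X]) (c : ℂ) (s : ℤˣ) (hc : IsSymmetricAbout p c) (l : ℕ)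
    (hl : Odd (l + p.natDegree)) : labelOp p c l ∈ DpHat p c s hc := by
  refine ⟨mon 0 ((X - C (c / 2)) ^ l), ?_, ?_⟩
  · change mon 0 _ = _
    rw [mon_mul_mon]; simp
  · change _ = -mon 0 _
    have h : ((-X + C c : ℂ[X]) - C (c / 2)) = (-1) * (X - C (c / 2)) := by
      have : (C c : ℂ[X]) = C (c / 2) + C (c / 2) := by rw [← C_add, add_halves]
      rw [this]; ring
    rw [sigmaZero_mon, smul_mul_assoc, mon_mul_mon, ← map_smul, ← map_neg]
    congr 1
    simp only [Int.cast_zero, C_0, sub_zero, add_zero, comp_X, pow_comp, sub_comp, X_comp,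
      C_comp, h, zpow_zero, Units.val_one, Int.cast_one, mul_one, mul_pow, smul_eq_C_mul, C_pow,
      C_neg, C_1]
    rw [show ((-1 : ℂ[X]) ^ p.natDegree * ((-1) ^ l * (X - C (c / 2)) ^ l * p)) =
      (-1) ^ (l + p.natDegree) * ((X - C (c / 2)) ^ l * p) by ring, hl.neg_one_pow]
    ring

theorem labelOp_mem_grading (p : ℂ[X]) (c : ℂ) (s : ℤˣ) (hc : IsSymmetricAbout p c) (l : ℕ)
    (hl : Odd (l + p.natDegree)) :
    (⟨labelOp p c l, labelOp_mem p c s hc l hl⟩ : DpHat p c s hc) ∈ grading p c s hc 0 :=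
  ⟨⟨_, rfl⟩, fun h => absurd rfl h⟩

open Classical in
/-- The series `∑ Δ_l x ^ l / l!` over the `l ≥ 0` of parity opposite to that of `deg p`, where
`Δ_l = -lam((D - c/2) ^ l p(D))`. -/
noncomputable def labelSeries (p : ℂ[X]) (c : ℂ) (s : ℤˣ) (hc : IsSymmetricAbout p c)
    (lam : Module.Dual ℂ (grading p c s hc 0)) : PowerSeries ℂ :=
  PowerSeries.mk fun l =>
    if hl : Odd (l + p.natDegree) then
      -lam ⟨⟨labelOp p c l, labelOp_mem p c s hc l hl⟩, labelOp_mem_grading p c s hc l hl⟩ /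
        (l.factorial : ℂ)
    else 0

/-- The series of `exp(α x)`. -/
noncomputable def expSeries (α : ℂ) : PowerSeries ℂ :=
  PowerSeries.rescale α (PowerSeries.exp ℂ)

/-- Quasipolynomials: linear combinations of `q(x) exp(α x)` with `q` a polynomial. -/
def IsQuasipolynomial (φ : PowerSeries ℂ) : Prop :=
  φ ∈ Submodule.span ℂ
    {ψ : PowerSeries ℂ | ∃ (q : ℂ[X]) (α : ℂ), ψ = (q : PowerSeries ℂ) * expSeries α}

/-- `φ(-x) = φ(x)`. -/
def IsEvenSeries (φ : PowerSeries ℂ) : Prop :=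
  PowerSeries.rescale (-1 : ℂ) φ = φ

/-- The series of `2 sinh(x/2)`. -/
noncomputable def twoSinhHalf : PowerSeries ℂ :=
  expSeries (1 / 2) - expSeries (-(1 / 2))

/-- The operator `p(d/dx + c/2)` on power series. -/
noncomputable def shiftedOp (p : ℂ[X]) (c : ℂ) : Module.End ℂ (PowerSeries ℂ) :=
  aeval ((PowerSeries.derivative ℂ : PowerSeries ℂ →ₗ[ℂ] PowerSeries ℂ) +
    (c / 2) • (1 : Module.End ℂ (PowerSeries ℂ))) p

end CircleOp

/-!
The module is quasifinite if and only if, in each degree `-k < 0`, the elements of `𝒟_p^±` that kill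
the highest weight vector have finite codimension. The highest weight of `h(D)` is `-Γ(h(X + c/2))`
for a functional `Γ` on polynomials. If `G` is its generating series `Γ(exp(x X))`, then `B(d/dx)`
acts on `G` as multiplication by `B` under `Γ`, so `Δ_λ = p(d/dx + c/2) G`. The highest weight of a
bracket of elements of degrees `k` and `-k` telescopes into values of the functional with generating
series `2 sinh(x/2) G + κ exp(-(c + 1)x/2)`, where `κ` is the highest weight of `C`. This functional
vanishes on `B ℂ[X]` for some `B ≠ 0` if and only if its series is annihilated by `B(d/dx)`, that
is, if and only if `2 sinh(x/2) G` is a quasipolynomial.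

Given such a `B`, the elements of degree `-k` whose coefficient is divisible by a product of `k`
shifts of `B` are stable under brackets with positive elements and kill the highest weight vector.
Conversely, quasifiniteness in degree `-1` yields an even `B`, but the functional is only seen to
vanish on the multiples of `B` by even polynomials. This suffices because `Γ` can be chosen so that
`2 sinh(x/2) G` is even: averaging over `x ↦ -x` loses nothing but exponentials.
-/

namespace CircleOp

/-! ### Enveloping algebras -/

section Enveloping

open UniversalEnvelopingAlgebra (ι)
open LieAlgebra (LieCharacter)

attribute [local instance] LieRing.ofAssociativeRing

local notation "𝒰" => UniversalEnvelopingAlgebra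

variable {R L : Type*} [CommRing R] [LieRing L] [LieAlgebra R L]

theorem ι_lie (x y : L) : ι R ⁅x, y⁆ = ι R x * ι R y - ι R y * ι R x := by
  rw [LieHom.map_lie, LieRing.of_associative_ring_bracket]

theorem ι_mul_ι (x y : L) : ι R x * ι R y = ι R y * ι R x + ι R ⁅x, y⁆ := by
  rw [ι_lie]; abel

theorem enveloping_eq_top {S : Submodule R (𝒰 R L)} (h_one : (1 : 𝒰 R L) ∈ S)
    (h_mul : ∀ (x : L), ∀ u ∈ S, ι R x * u ∈ S) : S = ⊤ := by
  let T : Subalgebra R (𝒰 R L) :=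
    { carrier := {u | ∀ a ∈ S, u * a ∈ S}
      mul_mem' := fun hu hw a ha => by rw [mul_assoc]; exact hu _ (hw _ ha)
      add_mem' := fun hu hw a ha => by rw [add_mul]; exact S.add_mem (hu _ ha) (hw _ ha)
      algebraMap_mem' := fun r a ha => by rw [← Algebra.smul_def]; exact S.smul_mem _ ha }
  let ιT : L →ₗ⁅R⁆ T :=
    { toFun := fun x => ⟨ι R x, h_mul x⟩
      map_add' := fun x y => Subtype.ext (map_add (ι R) x y)
      map_smul' := fun z x => Subtype.ext (map_smul (ι R) z x)
      map_lie' := fun {x y} => Subtype.ext (ι_lie x y) }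
  have section_T : T.val.comp (UniversalEnvelopingAlgebra.lift R ιT) = AlgHom.id R (𝒰 R L) := by
    ext x
    exact congrArg Subtype.val (UniversalEnvelopingAlgebra.lift_ι_apply R ιT x)
  refine eq_top_iff.2 fun u _ => ?_
  have hu : u ∈ T := by
    rw [← AlgHom.id_apply (R := R) u, ← section_T]
    exact (UniversalEnvelopingAlgebra.lift R ιT u).2
  simpa only [mul_one] using hu 1 h_one

theorem enveloping_induction {P : 𝒰 R L → Prop} (u : 𝒰 R L) (one : P 1)
    (add : ∀ a b, P a → P b → P (a + b)) (smul : ∀ (z : R) a, P a → P (z • a))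
    (ι_mul : ∀ x a, P a → P (ι R x * a)) : P u := by
  let S : Submodule R (𝒰 R L) :=
    { carrier := {u | P u}
      add_mem' := fun {a b} ha hb => add a b ha hb
      zero_mem' := zero_smul R (1 : 𝒰 R L) ▸ smul 0 1 one
      smul_mem' := smul }
  have hS : S = ⊤ := enveloping_eq_top one ι_mul
  exact (hS ▸ Submodule.mem_top : u ∈ S)

section Induced

/-- The action of a subalgebra `N` of `L` on the linear maps from `L` to `U(N)`. -/
noncomputable def homAction (N : LieSubalgebra R L) : N →ₗ⁅R⁆ Module.End R (L →ₗ[R] 𝒰 R N) where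
  toFun n :=
    { toFun := fun r => LinearMap.mulLeft R (ι R n) ∘ₗ r - r ∘ₗ LieAlgebra.ad R L (n : L)
      map_add' := fun r r' => by ext x; simp [mul_add]; abel
      map_smul' := fun z r => by ext x; simp [smul_sub] }
  map_add' n n' := by ext r x; simp [add_mul]; abel
  map_smul' z n := by ext r x; simp [smul_sub]
  map_lie' {n n'} := by
    ext r x
    change ι R ⁅n, n'⁆ * r x - r ⁅⁅(n : L), (n' : L)⁆, x⁆ =
      (ι R n * (ι R n' * r x - r ⁅(n' : L), x⁆) -
        (ι R n' * r ⁅(n : L), x⁆ - r ⁅(n' : L), ⁅(n : L), x⁆⁆)) -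
      (ι R n' * (ι R n * r x - r ⁅(n : L), x⁆) -
        (ι R n * r ⁅(n' : L), x⁆ - r ⁅(n : L), ⁅(n' : L), x⁆⁆))
    rw [ι_lie, lie_lie, map_sub]
    noncomm_ring

variable {N B : LieSubalgebra R L} (hNB : IsCompl N.toSubmodule B.toSubmodule)
  (χ : LieCharacter R B)

/-- The vectors `x • 1` of the module over `L = N ⊕ B` induced from the character `χ` of `B`, the
underlying space of which is identified with `U(N)`. -/
noncomputable def inducedVec : L →ₗ[R] 𝒰 R N :=
  (ι R : N →ₗ⁅R⁆ 𝒰 R N).toLinearMap ∘ₗ N.toSubmodule.projectionOnto _ hNB +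
    Algebra.linearMap R (𝒰 R N) ∘ₗ χ.toLinearMap ∘ₗ B.toSubmodule.projectionOnto _ hNB.symm

theorem inducedVec_coe_left (n : N) : inducedVec hNB χ n = ι R n := by
  have hN : N.toSubmodule.projectionOnto _ hNB n = n := Submodule.projectionOnto_apply_left hNB n
  have hB : B.toSubmodule.projectionOnto _ hNB.symm n = 0 :=
    Submodule.projectionOnto_apply_right hNB.symm n
  simp [inducedVec, hN, hB]

theorem inducedVec_coe_right (b : B) :
    inducedVec hNB χ b = algebraMap R (𝒰 R N) (χ b) := by
  have hN : N.toSubmodule.projectionOnto _ hNB b = 0 := Submodule.projectionOnto_apply_right hNB b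
  have hB : B.toSubmodule.projectionOnto _ hNB.symm b = b :=
    Submodule.projectionOnto_apply_left hNB.symm b
  simp [inducedVec, hN, hB]

/-- The map sending `a ∈ U(N)` and `x ∈ L` to `x • a` in the induced module. The action is forced by
`x • (n * a) = n * (x • a) - ⁅n, x⁆ • a`, which says that `a ↦ (x ↦ x • a)` is `N`-linear for
`homAction`; the universal property of `U(N)` thus defines it without the
Poincaré–Birkhoff–Witt theorem. -/
noncomputable def inducedAct : 𝒰 R N →ₗ[R] L →ₗ[R] 𝒰 R N :=
  LinearMap.applyₗ (inducedVec hNB χ) ∘ₗ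
    (UniversalEnvelopingAlgebra.lift R (homAction N)).toLinearMap

theorem inducedAct_one : inducedAct hNB χ 1 = inducedVec hNB χ := by
  simp [inducedAct]

theorem inducedAct_ι_mul (n : N) (a : 𝒰 R N) (x : L) :
    inducedAct hNB χ (ι R n * a) x =
      ι R n * inducedAct hNB χ a x - inducedAct hNB χ a ⁅(n : L), x⁆ := by
  simp only [inducedAct, LinearMap.comp_apply, AlgHom.toLinearMap_apply, map_mul,
    UniversalEnvelopingAlgebra.lift_ι_apply]
  rfl

theorem inducedAct_coe_left (a : 𝒰 R N) (n : N) : inducedAct hNB χ a n = ι R n * a := by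
  induction a using enveloping_induction generalizing n with
  | one => rw [inducedAct_one, inducedVec_coe_left, mul_one]
  | add a b ha hb => rw [map_add, LinearMap.add_apply, ha, hb, mul_add]
  | smul z a ha => rw [map_smul, LinearMap.smul_apply, ha, mul_smul_comm]
  | ι_mul m a ha =>
    rw [inducedAct_ι_mul, ← LieSubalgebra.coe_bracket, ha, ha, ι_lie]
    noncomm_ring

theorem inducedAct_lie_coe_left (a : 𝒰 R N) (n : N) (y : L) :
    inducedAct hNB χ a ⁅(n : L), y⁆ =
      inducedAct hNB χ (inducedAct hNB χ a y) n - inducedAct hNB χ (inducedAct hNB χ a n) y := by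
  rw [inducedAct_coe_left, inducedAct_coe_left, inducedAct_ι_mul, sub_sub_cancel]

theorem inducedAct_one_lie (x y : L) :
    inducedAct hNB χ 1 ⁅x, y⁆ =
      inducedAct hNB χ (inducedAct hNB χ 1 y) x - inducedAct hNB χ (inducedAct hNB χ 1 x) y := by
  obtain ⟨n, b, rfl⟩ : ∃ (n : N) (b : B), (n : L) + b = x := by
    obtain ⟨n, hn, b, hb, rfl⟩ := Submodule.mem_sup.1 (hNB.sup_eq_top ▸ Submodule.mem_top : x ∈ _)
    exact ⟨⟨n, hn⟩, ⟨b, hb⟩, rfl⟩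
  obtain ⟨m, d, rfl⟩ : ∃ (m : N) (d : B), (m : L) + d = y := by
    obtain ⟨m, hm, d, hd, rfl⟩ := Submodule.mem_sup.1 (hNB.sup_eq_top ▸ Submodule.mem_top : y ∈ _)
    exact ⟨⟨m, hm⟩, ⟨d, hd⟩, rfl⟩
  have h_left := inducedAct_lie_coe_left hNB χ 1 n (m + d)
  have h_right := inducedAct_lie_coe_left hNB χ 1 m b
  have h_base : inducedAct hNB χ 1 ⁅(b : L), (d : L)⁆ = inducedAct hNB χ (inducedAct hNB χ 1 d) b -
      inducedAct hNB χ (inducedAct hNB χ 1 b) d := by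
    rw [← LieSubalgebra.coe_bracket, inducedAct_one, inducedVec_coe_right, inducedVec_coe_right,
      inducedVec_coe_right, LieAlgebra.lieCharacter_apply_lie]
    simp [Algebra.algebraMap_eq_smul_one, inducedAct_one, inducedVec_coe_right, smul_smul, mul_comm]
  rw [add_lie, lie_add (b : L), ← lie_skew (b : L) (m : L), map_add, map_add, map_neg, h_left,
    h_right, h_base]
  simp only [map_add, LinearMap.add_apply]
  abel

theorem inducedAct_lie (a : 𝒰 R N) (x y : L) :
    inducedAct hNB χ a ⁅x, y⁆ =
      inducedAct hNB χ (inducedAct hNB χ a y) x - inducedAct hNB χ (inducedAct hNB χ a x) y := by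
  induction a using enveloping_induction generalizing x y with
  | one => exact inducedAct_one_lie hNB χ x y
  | add a b ha hb => simp only [map_add, LinearMap.add_apply, ha, hb]; abel
  | smul z a ha => simp only [map_smul, LinearMap.smul_apply, ha, smul_sub]
  | ι_mul n a ha =>
    simp only [inducedAct_ι_mul, map_sub, LinearMap.sub_apply]
    rw [leibniz_lie, map_add, ha ⁅(n : L), x⁆ y, ha x ⁅(n : L), y⁆, ha x y, mul_sub]
    abel

/-- The representation of `L` on the induced module. -/
noncomputable def inducedHom : L →ₗ⁅R⁆ Module.End R (𝒰 R N) where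
  __ := (inducedAct hNB χ).flip
  map_lie' {x y} := LinearMap.ext fun a => inducedAct_lie hNB χ a x y

include hNB in
/-- The functional takes `u` to the constant term of `u • 1` in the induced module. -/
theorem exists_highestWeight_functional : ∃ E : 𝒰 R L →ₗ[R] R, E 1 = 1 ∧
    (∀ (n : N) u, E (ι R (n : L) * u) = 0) ∧ ∀ (b : B) u, E (u * ι R (b : L)) = χ b * E u := by
  let Φ : 𝒰 R L →ₐ[R] Module.End R (𝒰 R N) :=
    UniversalEnvelopingAlgebra.lift R (inducedHom hNB χ)
  let ε : 𝒰 R N →ₐ[R] R := UniversalEnvelopingAlgebra.lift R (0 : N →ₗ⁅R⁆ R)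
  have Φ_ι (x : L) (a) : Φ (ι R x) a = inducedAct hNB χ a x := by
    simp only [Φ, UniversalEnvelopingAlgebra.lift_ι_apply]; rfl
  have ε_ι (n : N) : ε (ι R n) = 0 := UniversalEnvelopingAlgebra.lift_ι_apply R _ n
  refine ⟨ε.toLinearMap ∘ₗ LinearMap.applyₗ (1 : 𝒰 R N) ∘ₗ Φ.toLinearMap, ?_, fun n u => ?_,
    fun b u => ?_⟩
  · simp
  · change ε (Φ (ι R (n : L) * u) 1) = 0
    rw [map_mul, Module.End.mul_apply, Φ_ι, inducedAct_coe_left, map_mul, ε_ι, zero_mul]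
  · change ε (Φ (u * ι R (b : L)) 1) = χ b * ε (Φ u 1)
    rw [map_mul, Module.End.mul_apply, Φ_ι, inducedAct_one, inducedVec_coe_right,
      Algebra.algebraMap_eq_smul_one, map_smul, map_smul, smul_eq_mul]

end Induced

end Enveloping

/-! ### Words in negative elements -/

section Words

open UniversalEnvelopingAlgebra (ι)

attribute [local instance] LieRing.ofAssociativeRing

local notation "𝒰" => UniversalEnvelopingAlgebra

variable {R L M : Type*} [CommRing R] [LieRing L] [LieAlgebra R L] [AddCommGroup M] [Module R M]
  [Module (𝒰 R L) M]

/-- The vectors `x₁ ⋯ xₙ m` with `xᵢ ∈ Q dᵢ` and a seed `m ∈ S j`, all `dᵢ` being negative; the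
degree of such a vector is `d₁ + ⋯ + dₙ + j`. -/
inductive IsWord (Q : ℤ → Submodule R L) (S : ℤ → Set M) : ℤ → M → Prop
  | base {j : ℤ} {m : M} : m ∈ S j → IsWord Q S j m
  | mul {i j : ℤ} {x : L} {m : M} :
      i < 0 → x ∈ Q i → IsWord Q S j m → IsWord Q S (i + j) (ι R x • m)

/-- The span of the words of a given degree. -/
def wordSpan (Q : ℤ → Submodule R L) (S : ℤ → Set M) (j : ℤ) : Submodule R M :=
  Submodule.span R {m | IsWord Q S j m}

variable {Q gr : ℤ → Submodule R L} {S : ℤ → Set M} {i j : ℤ} {x : L} {m : M}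

theorem mem_wordSpan_of_mem (hm : m ∈ S j) : m ∈ wordSpan Q S j :=
  Submodule.subset_span (IsWord.base hm)

omit [Module R M] in
theorem IsWord.degree_nonpos (hS : ∀ i > 0, S i = ∅) (hm : IsWord Q S j m) : j ≤ 0 := by
  induction hm with
  | @base j m hm =>
    by_contra! hj
    simp [hS j hj] at hm
  | mul hi _ _ ih => omega

omit [Module R M] in
theorem ι_smul_ι_smul (x y : L) (m : M) :
    ι R x • ι R y • m = ι R y • ι R x • m + ι R ⁅x, y⁆ • m := by
  rw [smul_smul, ι_mul_ι, add_smul, mul_smul]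

variable [IsScalarTower R (𝒰 R L) M]

variable (R L M) in
/-- The action of `L` on a `U(L)`-module as a bilinear map. -/
noncomputable def lieAct : L →ₗ[R] M →ₗ[R] M :=
  (Algebra.lsmul R R M : 𝒰 R L →ₐ[R] Module.End R M).toLinearMap ∘ₗ (ι R).toLinearMap

theorem ι_smul_mem_wordSpan_of_neg (hi : i < 0) (hx : x ∈ Q i) (hm : m ∈ wordSpan Q S j) :
    ι R x • m ∈ wordSpan Q S (i + j) := by
  have h_le : wordSpan Q S j ≤ (wordSpan Q S (i + j)).comap (lieAct R L M x) :=
    Submodule.span_le.2 fun m hm => Submodule.subset_span (IsWord.mul hi hx hm)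
  exact h_le hm

theorem IsWord.ι_smul_mem_wordSpan
    (hgr : ∀ {i j : ℤ} {x y : L}, x ∈ gr i → y ∈ gr j → ⁅x, y⁆ ∈ gr (i + j)) (hQ : Q ≤ gr)
    (hS : ∀ {i j}, ∀ x ∈ gr i, ∀ m ∈ S j, ι R x • m ∈ wordSpan Q S (i + j))
    (hm : IsWord Q S j m) (hx : x ∈ gr i) : ι R x • m ∈ wordSpan Q S (i + j) := by
  induction hm generalizing i x with
  | base hm => exact hS x hx _ hm
  | @mul k l y m hk hy _ ih =>
    rw [ι_smul_ι_smul]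
    refine Submodule.add_mem _ ?_ ?_
    · rw [add_left_comm]
      exact ι_smul_mem_wordSpan_of_neg hk hy (ih hx)
    · rw [← add_assoc]
      exact ih (hgr hx (hQ k hy))

theorem ι_smul_mem_wordSpan
    (hgr : ∀ {i j : ℤ} {x y : L}, x ∈ gr i → y ∈ gr j → ⁅x, y⁆ ∈ gr (i + j)) (hQ : Q ≤ gr)
    (hS : ∀ {i j}, ∀ x ∈ gr i, ∀ m ∈ S j, ι R x • m ∈ wordSpan Q S (i + j))
    (hx : x ∈ gr i) (hm : m ∈ wordSpan Q S j) : ι R x • m ∈ wordSpan Q S (i + j) := by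
  have h_le : wordSpan Q S j ≤ (wordSpan Q S (i + j)).comap (lieAct R L M x) :=
    Submodule.span_le.2 fun m hm => hm.ι_smul_mem_wordSpan hgr hQ hS hx
  exact h_le hm

theorem wordSpan_eq_sup (hS : ∀ i > 0, S i = ∅) (j : ℤ) :
    wordSpan Q S j = Submodule.span R (S j) ⊔
      ⨆ i ∈ Finset.Ico j 0, Submodule.map₂ (lieAct R L M) (Q i) (wordSpan Q S (j - i)) := by
  refine le_antisymm (Submodule.span_le.2 fun m (hm : IsWord Q S j m) => ?_) (sup_le ?_ ?_)
  · cases hm with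
    | base hm => exact Submodule.mem_sup_left (Submodule.subset_span hm)
    | @mul i j x m hi hx hm =>
      have hj := hm.degree_nonpos hS
      refine Submodule.mem_sup_right (Submodule.mem_iSup_of_mem i (Submodule.mem_iSup_of_mem ?_ ?_))
      · rw [Finset.mem_Ico]; omega
      · rw [add_sub_cancel_left]
        exact Submodule.apply_mem_map₂ (lieAct R L M) hx (Submodule.subset_span hm)
  · exact Submodule.span_le.2 fun m hm => mem_wordSpan_of_mem hm
  · refine iSup₂_le fun i hi => Submodule.map₂_le.2 fun x hx m hm => ?_
    have h_mem := ι_smul_mem_wordSpan_of_neg (Finset.mem_Ico.1 hi).2 hx hm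
    rwa [add_sub_cancel] at h_mem

theorem fg_wordSpan (hQ : ∀ i < 0, (Q i).FG) (hS_fin : ∀ i, (S i).Finite)
    (hS : ∀ i > 0, S i = ∅) (j : ℤ) : (wordSpan Q S j).FG := by
  induction hn : (-j).toNat using Nat.strong_induction_on generalizing j with
  | _ n ih =>
    rw [wordSpan_eq_sup hS]
    refine (Submodule.fg_span (hS_fin j)).sup (Submodule.fg_biSup _ _ fun i hi => ?_)
    rw [Finset.mem_Ico] at hi
    exact (hQ i hi.2).map₂ _ (ih _ (by omega) (j - i) rfl)

end Words

/-! ### Gradations and Verma modules -/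

theorem lie_mem_of_mem_biSup {R L : Type*} [CommRing R] [LieRing L] [LieAlgebra R L]
    {gr : ℤ → Submodule R L} {D : Set ℤ} {P : Submodule R L}
    (hP : ∀ i ∈ D, ∀ j ∈ D, ∀ x ∈ gr i, ∀ y ∈ gr j, ⁅x, y⁆ ∈ P)
    {x y : L} (hx : x ∈ ⨆ i ∈ D, gr i) (hy : y ∈ ⨆ i ∈ D, gr i) : ⁅x, y⁆ ∈ P := by
  rw [iSup_subtype'] at hx hy
  induction hx using Submodule.iSup_induction' with
  | zero => rw [zero_lie]; exact zero_mem _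
  | add x x' _ _ hx hx' => rw [add_lie]; exact add_mem hx hx'
  | mem i x hx =>
    induction hy using Submodule.iSup_induction' with
    | zero => rw [lie_zero]; exact zero_mem _
    | add y y' _ _ hy hy' => rw [lie_add]; exact add_mem hy hy'
    | mem j y hy => exact hP i i.2 j j.2 x hx y hy

/-- `L` is the direct sum of the subspaces `gr i`, and the bracket adds degrees. -/
structure IsLieGradation {R L : Type*} [CommRing R] [LieRing L] [LieAlgebra R L]
    (gr : ℤ → Submodule R L) : Prop where
  lie_mem : ∀ {i j : ℤ} {x y : L}, x ∈ gr i → y ∈ gr j → ⁅x, y⁆ ∈ gr (i + j)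
  independent : iSupIndep gr
  iSup_eq_top : ⨆ i, gr i = ⊤

namespace IsLieGradation

variable {R L : Type*} [CommRing R] [LieRing L] [LieAlgebra R L] {gr : ℤ → Submodule R L}
  (hgr : IsLieGradation gr)

include hgr in
theorem isCompl_biSup {D E : Set ℤ} (hDE : IsCompl D E) :
    IsCompl (⨆ i ∈ D, gr i) (⨆ i ∈ E, gr i) := by
  refine ⟨hgr.independent.disjoint_biSup_biSup hDE.disjoint, codisjoint_iff.2 ?_⟩
  have h_univ : D ∪ E = Set.univ := hDE.sup_eq_top
  rw [← iSup_union, h_univ, iSup_univ, hgr.iSup_eq_top]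

include hgr in
theorem isCompl_zero : IsCompl (gr 0) (⨆ i ∈ ({0}ᶜ : Set ℤ), gr i) := by
  simpa only [iSup_singleton] using hgr.isCompl_biSup (isCompl_compl (x := ({0} : Set ℤ)))

/-- The sum of the components whose degrees lie in an additively closed set. -/
def subalgebra (D : Set ℤ) (hD : ∀ i ∈ D, ∀ j ∈ D, i + j ∈ D) : LieSubalgebra R L where
  __ := ⨆ i ∈ D, gr i
  lie_mem' := lie_mem_of_mem_biSup fun i hi j hj _ hx _ hy =>
    le_biSup gr (hD i hi j hj) (hgr.lie_mem hx hy)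

theorem mem_subalgebra {D : Set ℤ} {hD} {j : ℤ} (hj : j ∈ D) {x : L} (hx : x ∈ gr j) :
    x ∈ hgr.subalgebra D hD :=
  le_biSup gr hj hx

/-- The subalgebra `⨁_{j < 0} gr j`. -/
abbrev negPart : LieSubalgebra R L :=
  hgr.subalgebra (Set.Iio 0) fun _ hi _ hj => Set.mem_Iio.2 (add_neg (Set.mem_Iio.1 hi) hj)

/-- The subalgebra `⨁_{j ≥ 0} gr j`. -/
abbrev nonnegPart : LieSubalgebra R L :=
  hgr.subalgebra (Set.Ici 0) fun _ hi _ hj => Set.mem_Ici.2 (add_nonneg (Set.mem_Ici.1 hi) hj)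

theorem isCompl_negPart_nonnegPart :
    IsCompl hgr.negPart.toSubmodule hgr.nonnegPart.toSubmodule :=
  hgr.isCompl_biSup (by rw [← Set.compl_Iio]; exact isCompl_compl)

end IsLieGradation

section Verma

open UniversalEnvelopingAlgebra (ι)
open LieAlgebra (LieCharacter)

attribute [local instance] LieRing.ofAssociativeRing

local notation "𝒰" => UniversalEnvelopingAlgebra ℂ

variable {L : Type*} [LieRing L] [LieAlgebra ℂ L] {gr : ℤ → Submodule ℂ L}
  {lam : Module.Dual ℂ (gr 0)}

/-- The extension by `0` of a functional on `gr 0` to the nonnegative part of `L`. -/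
noncomputable def nonnegCharacter (hgr : IsLieGradation gr) (lam : Module.Dual ℂ (gr 0))
    (hlam : ∀ x ∈ gr 0, ∀ y ∈ gr 0, ∀ z : gr 0, (z : L) = ⁅x, y⁆ → lam z = 0) :
    LieCharacter ℂ hgr.nonnegPart where
  __ := lam ∘ₗ (gr 0).projectionOnto _ hgr.isCompl_zero ∘ₗ Submodule.subtype _
  map_lie' {x y} := by
    rw [LieRing.of_associative_ring_bracket, mul_comm, sub_self]
    refine lie_mem_of_mem_biSup (gr := gr) (D := Set.Ici 0)
      (P := LinearMap.ker (lam ∘ₗ (gr 0).projectionOnto _ hgr.isCompl_zero)) ?_ x.2 y.2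
    intro i hi j hj x hx y hy
    rw [LinearMap.mem_ker, LinearMap.comp_apply]
    have h_mem := hgr.lie_mem hx hy
    rcases eq_or_ne (i + j) 0 with hij | hij
    · obtain ⟨rfl, rfl⟩ := (add_eq_zero_iff_of_nonneg hi hj).1 hij
      exact hlam x hx y hy _ (by
        rw [(gr 0).projectionOnto_apply_of_mem_left hgr.isCompl_zero h_mem])
    · rw [Submodule.projectionOnto_apply_of_mem_right hgr.isCompl_zero
        (le_biSup gr (show i + j ∈ ({0}ᶜ : Set ℤ) from hij) h_mem), map_zero]

theorem nonnegCharacter_of_mem_zero {hgr : IsLieGradation gr} {hlam} (h : gr 0) {hh} :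
    nonnegCharacter hgr lam hlam ⟨h, hh⟩ = lam h :=
  congrArg lam (Submodule.projectionOnto_apply_left hgr.isCompl_zero h)

theorem nonnegCharacter_of_mem_pos {hgr : IsLieGradation gr} {hlam} {j : ℤ} (hj : 0 < j) {x : L}
    (hx : x ∈ gr j) {hx'} : nonnegCharacter hgr lam hlam ⟨x, hx'⟩ = 0 := by
  change lam ((gr 0).projectionOnto _ hgr.isCompl_zero x) = 0
  rw [Submodule.projectionOnto_apply_of_mem_right hgr.isCompl_zero
    (le_biSup gr (show j ∈ ({0}ᶜ : Set ℤ) from hj.ne') hx), map_zero]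

/-- The highest weight vector. -/
noncomputable def vermaVec (gr : ℤ → Submodule ℂ L) (lam : Module.Dual ℂ (gr 0)) : Verma gr lam :=
  Submodule.Quotient.mk 1

theorem mk_eq_smul_vermaVec (u : 𝒰 L) :
    (Submodule.Quotient.mk u : Verma gr lam) = u • vermaVec gr lam := by
  rw [vermaVec, ← Submodule.Quotient.mk_smul, smul_eq_mul, mul_one]

theorem exists_smul_vermaVec (m : Verma gr lam) : ∃ u : 𝒰 L, u • vermaVec gr lam = m := by
  obtain ⟨u, rfl⟩ := Submodule.Quotient.mk_surjective _ m
  exact ⟨u, (mk_eq_smul_vermaVec u).symm⟩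

theorem ι_smul_vermaVec_of_pos {j : ℤ} (hj : 0 < j) {x : L} (hx : x ∈ gr j) :
    ι ℂ x • vermaVec gr lam = 0 := by
  rw [← mk_eq_smul_vermaVec, Submodule.Quotient.mk_eq_zero]
  exact Submodule.subset_span (Or.inl ⟨j, hj, x, hx, rfl⟩)

theorem ι_smul_vermaVec_of_zero (h : gr 0) :
    ι ℂ (h : L) • vermaVec gr lam = lam h • vermaVec gr lam := by
  rw [← sub_eq_zero, ← algebraMap_smul (𝒰 L) (lam h), ← sub_smul, ← mk_eq_smul_vermaVec,
    Submodule.Quotient.mk_eq_zero]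
  exact Submodule.subset_span (Or.inr ⟨h, rfl⟩)

/-- `π` is the functional on the Verma module that takes the coefficient of the highest weight
vector. -/
structure IsHighestWeightCoeff (gr : ℤ → Submodule ℂ L) (lam : Module.Dual ℂ (gr 0))
    (π : Verma gr lam →ₗ[ℂ] ℂ) : Prop where
  map_vermaVec : π (vermaVec gr lam) = 1
  map_ι_smul : ∀ {j : ℤ}, j < 0 → ∀ {x : L}, x ∈ gr j → ∀ m, π (ι ℂ x • m) = 0

theorem exists_isHighestWeightCoeff (hgr : IsLieGradation gr)
    (hlam : ∀ x ∈ gr 0, ∀ y ∈ gr 0, ∀ z : gr 0, (z : L) = ⁅x, y⁆ → lam z = 0) :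
    ∃ π, IsHighestWeightCoeff gr lam π := by
  obtain ⟨E, E_one, E_neg, E_nonneg⟩ :=
    exists_highestWeight_functional hgr.isCompl_negPart_nonnegPart (nonnegCharacter hgr lam hlam)
  have E_vermaIdeal : ∀ u ∈ vermaIdeal gr lam, ∀ w, E (w * u) = 0 := by
    intro u hu
    induction hu using Submodule.span_induction with
    | zero => intro w; rw [mul_zero, map_zero]
    | add a b _ _ ha hb => intro w; rw [mul_add, map_add, ha, hb, add_zero]
    | smul a u _ hu => intro w; rw [smul_eq_mul, ← mul_assoc, hu]
    | mem u hu =>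
      intro w
      rcases hu with ⟨j, hj, x, hx, rfl⟩ | ⟨h, rfl⟩
      · rw [E_nonneg ⟨x, hgr.mem_subalgebra (Set.mem_Ici.2 hj.le) hx⟩,
          nonnegCharacter_of_mem_pos hj hx, zero_mul]
      · rw [mul_sub, map_sub, ← Algebra.commutes, ← Algebra.smul_def, map_smul, smul_eq_mul,
          E_nonneg ⟨h, hgr.mem_subalgebra (Set.mem_Ici.2 le_rfl) h.2⟩,
          nonnegCharacter_of_mem_zero, sub_self]
  let π : Verma gr lam →ₗ[ℂ] ℂ :=
    ((vermaIdeal gr lam).restrictScalars ℂ).liftQ E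
      (fun u hu => LinearMap.mem_ker.2 (by simpa only [one_mul] using E_vermaIdeal u hu 1)) ∘ₗ
    (Submodule.Quotient.restrictScalarsEquiv ℂ (vermaIdeal gr lam)).symm.toLinearMap
  refine ⟨π, E_one, fun {j} hj {x} hx m => ?_⟩
  obtain ⟨u, rfl⟩ := Submodule.Quotient.mk_surjective _ m
  exact E_neg ⟨x, hgr.mem_subalgebra (Set.mem_Iio.2 hj) hx⟩ u

end Verma

/-! ### The maximal graded submodule -/

section MaxGraded

open UniversalEnvelopingAlgebra (ι)

attribute [local instance] LieRing.ofAssociativeRing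

local notation "𝒰" => UniversalEnvelopingAlgebra ℂ

variable {L : Type*} [LieRing L] [LieAlgebra ℂ L] {gr : ℤ → Submodule ℂ L}

theorem IsMonomial.mul_mem {i j : ℤ} {u w : 𝒰 L} (hu : IsMonomial gr i u)
    (hw : IsMonomial gr j w) : IsMonomial gr (i + j) (u * w) := by
  induction hu with
  | one => rwa [zero_add, one_mul]
  | mul hx _ ih =>
    rw [mul_assoc, add_assoc]
    exact IsMonomial.mul hx ih

theorem mul_mem_envelopingGrade {i j : ℤ} {u w : 𝒰 L} (hu : u ∈ envelopingGrade gr i)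
    (hw : w ∈ envelopingGrade gr j) : u * w ∈ envelopingGrade gr (i + j) := by
  have h_le : envelopingGrade gr i * envelopingGrade gr j ≤ envelopingGrade gr (i + j) := by
    rw [envelopingGrade, envelopingGrade, Submodule.span_mul_span, Submodule.span_le]
    rintro _ ⟨a, ha, b, hb, rfl⟩
    exact Submodule.subset_span (ha.mul_mem hb)
  exact h_le (Submodule.mul_mem_mul hu hw)

theorem ι_mem_envelopingGrade {i : ℤ} {x : L} (hx : x ∈ gr i) :
    ι ℂ x ∈ envelopingGrade gr i := by
  have h_monomial := IsMonomial.mul hx (IsMonomial.one (gr := gr))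
  rw [mul_one, add_zero] at h_monomial
  exact Submodule.subset_span h_monomial

theorem iSup_envelopingGrade (hgr : ⨆ i, gr i = ⊤) : ⨆ i, envelopingGrade gr i = ⊤ := by
  refine enveloping_eq_top (Submodule.mem_iSup_of_mem 0 (Submodule.subset_span IsMonomial.one))
    fun x u hu => ?_
  have hx : x ∈ ⨆ i, gr i := hgr ▸ Submodule.mem_top
  induction hx using Submodule.iSup_induction' with
  | zero => rw [map_zero, zero_mul]; exact zero_mem _
  | add x y _ _ hx hy => rw [map_add, add_mul]; exact add_mem hx hy
  | mem i x hx =>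
    induction hu using Submodule.iSup_induction' with
    | zero => rw [mul_zero]; exact zero_mem _
    | add a b _ _ ha hb => rw [mul_add]; exact add_mem ha hb
    | mem j u hu =>
      exact Submodule.mem_iSup_of_mem (i + j)
        (mul_mem_envelopingGrade (ι_mem_envelopingGrade hx) hu)

section HighestWeightVector

variable {M : Type*} [AddCommGroup M] [Module ℂ M] [Module (𝒰 L) M] [IsScalarTower ℂ (𝒰 L) M]
  {Q : ℤ → Submodule ℂ L} {lam : Module.Dual ℂ (gr 0)} {v : M}

theorem smul_mem_wordSpan_of_mem_envelopingGrade {S : ℤ → Set M}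
    (hgr : ∀ {i j : ℤ} {x y : L}, x ∈ gr i → y ∈ gr j → ⁅x, y⁆ ∈ gr (i + j)) (hQ : Q ≤ gr)
    (hS : ∀ {i j}, ∀ x ∈ gr i, ∀ m ∈ S j, ι ℂ x • m ∈ wordSpan Q S (i + j))
    {i j : ℤ} {u : 𝒰 L} (hu : u ∈ envelopingGrade gr i) {m : M} (hm : m ∈ wordSpan Q S j) :
    u • m ∈ wordSpan Q S (i + j) := by
  induction hu using Submodule.span_induction with
  | mem u hu =>
    induction hu with
    | one => rwa [one_smul, zero_add]
    | mul hx _ ih => rw [mul_smul, add_assoc]; exact ι_smul_mem_wordSpan hgr hQ hS hx ih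
  | zero => rw [zero_smul]; exact zero_mem _
  | add a b _ _ ha hb => rw [add_smul]; exact add_mem ha hb
  | smul z a _ ha => rw [smul_assoc]; exact Submodule.smul_mem _ _ ha

/-- `v` is killed by the elements of positive degree, and those of degree `0` act on it through
`lam`. -/
structure IsHighestWeightVector (lam : Module.Dual ℂ (gr 0)) (v : M) : Prop where
  ι_smul_of_pos : ∀ {j : ℤ}, 0 < j → ∀ {x : L}, x ∈ gr j → ι ℂ x • v = 0
  ι_smul_of_zero : ∀ h : gr 0, ι ℂ (h : L) • v = lam h • v

/-- The seeds with `v` in degree `0` as the only one. -/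
def vectorSeed (v : M) (j : ℤ) : Set M :=
  {m | j = 0 ∧ m = v}

omit [AddCommGroup M] [Module ℂ M] in
theorem vectorSeed_of_pos {j : ℤ} (hj : j > 0) : vectorSeed v j = ∅ :=
  Set.eq_empty_of_forall_notMem fun _ hm => hj.ne' hm.1

omit [IsScalarTower ℂ (𝒰 L) M] in
theorem mem_wordSpan_vectorSeed : v ∈ wordSpan Q (vectorSeed v) 0 :=
  mem_wordSpan_of_mem ⟨rfl, rfl⟩

theorem IsHighestWeightVector.ι_smul_mem_wordSpan (hv : IsHighestWeightVector lam v)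
    (hQ : ∀ i < 0, ∀ x ∈ gr i, ∃ q ∈ Q i, ι ℂ x • v = ι ℂ q • v)
    {i j : ℤ} (x : L) (hx : x ∈ gr i) (m : M) (hm : m ∈ vectorSeed v j) :
    ι ℂ x • m ∈ wordSpan Q (vectorSeed v) (i + j) := by
  obtain ⟨rfl, rfl⟩ := hm
  rcases lt_trichotomy i 0 with hi | rfl | hi
  · obtain ⟨q, hq, h_eq⟩ := hQ i hi x hx
    rw [h_eq]
    exact ι_smul_mem_wordSpan_of_neg hi hq mem_wordSpan_vectorSeed
  · rw [hv.ι_smul_of_zero ⟨x, hx⟩, add_zero]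
    exact Submodule.smul_mem _ _ mem_wordSpan_vectorSeed
  · rw [hv.ι_smul_of_pos hi hx]
    exact zero_mem _

/-- Subspaces `P k` of `gr k`, those with `k < 0` being stable under the nonnegative part of `L`
as long as the degree stays negative, and bracketing into the kernel of `lam` in degree `0`. Such a
family annihilates the highest weight vector of the irreducible module. -/
structure IsSingularFamily (lam : Module.Dual ℂ (gr 0)) (P : ℤ → Submodule ℂ L) : Prop where
  le : P ≤ gr
  lie_mem : ∀ {j k : ℤ}, 0 ≤ j → j + k < 0 → ∀ {y x : L}, y ∈ gr j → x ∈ P k → ⁅y, x⁆ ∈ P (j + k)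
  weight_lie : ∀ {j : ℤ}, 0 < j → ∀ {y x : L}, y ∈ gr j → x ∈ P (-j) →
    ∀ z : gr 0, (z : L) = ⁅y, x⁆ → lam z = 0

/-- The seeds `x v` with `x ∈ P k` and `k < 0`. -/
def familySeed (P : ℤ → Submodule ℂ L) (v : M) (k : ℤ) : Set M :=
  {m | k < 0 ∧ ∃ x ∈ P k, ι ℂ x • v = m}

variable {P : ℤ → Submodule ℂ L}

omit [IsScalarTower ℂ (𝒰 L) M] in
theorem IsSingularFamily.ι_lie_smul_mem_wordSpan (hgr : IsLieGradation gr)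
    (hP : IsSingularFamily lam P) (hv : IsHighestWeightVector lam v) {i k : ℤ} (hi : 0 ≤ i)
    (hk : k < 0) {x y : L} (hy : y ∈ gr i) (hx : x ∈ P k) :
    ι ℂ ⁅y, x⁆ • v ∈ wordSpan gr (familySeed P v) (i + k) := by
  have h_mem := hgr.lie_mem hy (hP.le k hx)
  rcases lt_trichotomy (i + k) 0 with hik | hik | hik
  · exact mem_wordSpan_of_mem ⟨hik, _, hP.lie_mem hi hik hy hx, rfl⟩
  · obtain rfl : k = -i := by omega
    rw [add_neg_cancel] at h_mem
    rw [hv.ι_smul_of_zero ⟨_, h_mem⟩, hP.weight_lie (by omega) hy hx _ rfl, zero_smul]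
    exact zero_mem _
  · rw [hv.ι_smul_of_pos hik h_mem]
    exact zero_mem _

theorem IsSingularFamily.ι_smul_mem_wordSpan (hgr : IsLieGradation gr)
    (hP : IsSingularFamily lam P) (hv : IsHighestWeightVector lam v) {i k : ℤ}
    (y : L) (hy : y ∈ gr i) (m : M) (hm : m ∈ familySeed P v k) :
    ι ℂ y • m ∈ wordSpan gr (familySeed P v) (i + k) := by
  obtain ⟨hk, x, hx, rfl⟩ := hm
  have h_seed : ι ℂ x • v ∈ wordSpan gr (familySeed P v) k :=
    mem_wordSpan_of_mem ⟨hk, x, hx, rfl⟩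
  rcases lt_or_ge i 0 with hi | hi
  · exact ι_smul_mem_wordSpan_of_neg hi hy h_seed
  rw [ι_smul_ι_smul]
  refine add_mem ?_ (hP.ι_lie_smul_mem_wordSpan hgr hv hi hk hy hx)
  rcases hi.eq_or_lt with rfl | hi
  · rw [hv.ι_smul_of_zero ⟨y, hy⟩, smul_comm, zero_add]
    exact Submodule.smul_mem _ _ h_seed
  · rw [hv.ι_smul_of_pos hi hy, smul_zero]
    exact zero_mem _

end HighestWeightVector

section Coefficient

variable {lam : Module.Dual ℂ (gr 0)} {π : Verma gr lam →ₗ[ℂ] ℂ}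

theorem isHighestWeightVector_vermaVec : IsHighestWeightVector lam (vermaVec gr lam) :=
  ⟨ι_smul_vermaVec_of_pos, ι_smul_vermaVec_of_zero⟩

theorem mem_vermaGrade_iff {j : ℤ} {m : Verma gr lam} :
    m ∈ vermaGrade gr lam j ↔ ∃ u ∈ envelopingGrade gr j, u • vermaVec gr lam = m := by
  simp only [← mk_eq_smul_vermaVec]
  rfl

theorem ι_smul_vermaVec_mem_vermaGrade {j : ℤ} {x : L} (hx : x ∈ gr j) :
    ι ℂ x • vermaVec gr lam ∈ vermaGrade gr lam j :=
  mem_vermaGrade_iff.2 ⟨_, ι_mem_envelopingGrade hx, rfl⟩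

theorem smul_mem_vermaGrade {i j : ℤ} {u : 𝒰 L} {m : Verma gr lam}
    (hu : u ∈ envelopingGrade gr i) (hm : m ∈ vermaGrade gr lam j) :
    u • m ∈ vermaGrade gr lam (i + j) := by
  obtain ⟨w, hw, rfl⟩ := mem_vermaGrade_iff.1 hm
  exact mem_vermaGrade_iff.2 ⟨u * w, mul_mem_envelopingGrade hu hw, mul_smul _ _ _⟩

theorem vermaGrade_le_wordSpan (hgr : IsLieGradation gr) (j : ℤ) :
    vermaGrade gr lam j ≤ wordSpan gr (vectorSeed (vermaVec gr lam)) j := by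
  intro m hm
  obtain ⟨u, hu, rfl⟩ := mem_vermaGrade_iff.1 hm
  rw [← add_zero j]
  exact smul_mem_wordSpan_of_mem_envelopingGrade hgr.lie_mem le_rfl
    (isHighestWeightVector_vermaVec.ι_smul_mem_wordSpan fun _ _ x hx => ⟨x, hx, rfl⟩)
    hu mem_wordSpan_vectorSeed

theorem vermaGrade_zero_le_span (hgr : IsLieGradation gr) :
    vermaGrade gr lam 0 ≤ Submodule.span ℂ {vermaVec gr lam} := by
  refine (vermaGrade_le_wordSpan hgr 0).trans (Submodule.span_le.2 fun m hm => ?_)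
  generalize hj : (0 : ℤ) = j at hm
  cases hm with
  | base hm => rw [hm.2]; exact Submodule.mem_span_singleton_self _
  | mul hi _ hm =>
    have := hm.degree_nonpos fun _ => vectorSeed_of_pos
    omega

theorem eq_top_of_vermaVec_mem {N : Submodule (𝒰 L) (Verma gr lam)} (hN : vermaVec gr lam ∈ N) :
    N = ⊤ := by
  refine eq_top_iff.2 fun m _ => ?_
  obtain ⟨u, rfl⟩ := exists_smul_vermaVec m
  exact N.smul_mem u hN

theorem isGradedSubmodule_span_singleton (hgr : ⨆ i, gr i = ⊤) {k : ℤ} {w : Verma gr lam}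
    (hw : w ∈ vermaGrade gr lam k) :
    IsGradedSubmodule gr lam (Submodule.span (𝒰 L) {w}) := by
  refine le_antisymm (fun m hm => ?_) (iSup_le fun j => inf_le_left)
  obtain ⟨u, rfl⟩ := Submodule.mem_span_singleton.1 ((Submodule.restrictScalars_mem _ _ _).1 hm)
  have hu : u ∈ ⨆ i, envelopingGrade gr i := iSup_envelopingGrade hgr ▸ Submodule.mem_top
  clear hm
  induction hu using Submodule.iSup_induction' with
  | zero => rw [zero_smul]; exact zero_mem _
  | add a b _ _ ha hb => rw [add_smul]; exact add_mem ha hb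
  | mem i u hu =>
    exact Submodule.mem_iSup_of_mem (i + k) ⟨Submodule.smul_mem _ u
      (Submodule.mem_span_singleton_self w), smul_mem_vermaGrade hu hw⟩

namespace IsHighestWeightCoeff

variable (hπ : IsHighestWeightCoeff gr lam π)

include hπ

theorem map_eq_zero_of_mem_vermaGrade (hgr : IsLieGradation gr) {j : ℤ} (hj : j ≠ 0)
    {m : Verma gr lam} (hm : m ∈ vermaGrade gr lam j) : π m = 0 := by
  have h_le : wordSpan gr (vectorSeed (vermaVec gr lam)) j ≤ LinearMap.ker π := by
    refine Submodule.span_le.2 fun m hm => ?_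
    cases hm with
    | base hm => exact absurd hm.1 hj
    | mul hi hx _ => exact hπ.map_ι_smul hi hx _
  exact h_le (vermaGrade_le_wordSpan hgr j hm)

theorem map_eq_zero_of_isGradedSubmodule (hgr : IsLieGradation gr)
    {N : Submodule (𝒰 L) (Verma gr lam)} (hN : IsGradedSubmodule gr lam N) (hN_top : N ≠ ⊤)
    {m : Verma gr lam} (hm : m ∈ N) : π m = 0 := by
  suffices h_le : N.restrictScalars ℂ ≤ LinearMap.ker π from h_le hm
  rw [hN]
  refine iSup_le fun j => ?_
  rintro m ⟨hmN, hmj⟩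
  rcases eq_or_ne j 0 with rfl | hj
  · obtain ⟨z, rfl⟩ := Submodule.mem_span_singleton.1 (vermaGrade_zero_le_span hgr hmj)
    rcases eq_or_ne z 0 with rfl | hz
    · rw [zero_smul]; exact zero_mem _
    · exact absurd (eq_top_of_vermaVec_mem
        ((Submodule.smul_mem_iff (N.restrictScalars ℂ) hz).1 hmN)) hN_top
  · exact hπ.map_eq_zero_of_mem_vermaGrade hgr hj hmj

theorem map_eq_zero_of_mem_maxGradedSubmodule (hgr : IsLieGradation gr) {m : Verma gr lam}
    (hm : m ∈ maxGradedSubmodule gr lam) : π m = 0 := by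
  rw [maxGradedSubmodule, sSup_eq_iSup'] at hm
  induction hm using Submodule.iSup_induction' with
  | mem N m hm => exact hπ.map_eq_zero_of_isGradedSubmodule hgr N.2.1 N.2.2 hm
  | zero => exact map_zero π
  | add a b _ _ ha hb => rw [map_add, ha, hb, add_zero]

theorem mem_maxGradedSubmodule (hgr : ⨆ i, gr i = ⊤) {k : ℤ} {w : Verma gr lam}
    (hw : w ∈ vermaGrade gr lam k) (hπw : ∀ u : 𝒰 L, π (u • w) = 0) :
    w ∈ maxGradedSubmodule gr lam := by
  have h_le : Submodule.span (𝒰 L) {w} ≤ maxGradedSubmodule gr lam := by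
    refine le_sSup ⟨isGradedSubmodule_span_singleton hgr hw, fun h_top => ?_⟩
    obtain ⟨u, hu⟩ :=
      Submodule.mem_span_singleton.1 (h_top ▸ Submodule.mem_top (x := vermaVec gr lam))
    have h_zero := hπw u
    rw [hu, hπ.map_vermaVec] at h_zero
    exact one_ne_zero h_zero
  exact h_le (Submodule.mem_span_singleton_self w)

theorem ι_smul_vermaVec_mem_maxGradedSubmodule (hgr : IsLieGradation gr)
    {P : ℤ → Submodule ℂ L} (hP : IsSingularFamily lam P) {k : ℤ} (hk : k < 0) {x : L}
    (hx : x ∈ P k) : ι ℂ x • vermaVec gr lam ∈ maxGradedSubmodule gr lam := by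
  refine hπ.mem_maxGradedSubmodule hgr.iSup_eq_top
    (ι_smul_vermaVec_mem_vermaGrade (hP.le k hx)) fun u => ?_
  have h_le : ∀ j, wordSpan gr (familySeed P (vermaVec gr lam)) j ≤ LinearMap.ker π := by
    refine fun j => Submodule.span_le.2 fun m hm => ?_
    cases hm with
    | base hm =>
      obtain ⟨hj, x, hx, rfl⟩ := hm
      exact hπ.map_ι_smul hj (hP.le j hx) _
    | mul hi hx _ => exact hπ.map_ι_smul hi hx _
  have hu : u ∈ ⨆ i, envelopingGrade gr i :=
    iSup_envelopingGrade hgr.iSup_eq_top ▸ Submodule.mem_top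
  induction hu using Submodule.iSup_induction' with
  | zero => rw [zero_smul, map_zero]
  | add a b _ _ ha hb => rw [add_smul, map_add, ha, hb, add_zero]
  | mem i u hu =>
    exact h_le (i + k) (smul_mem_wordSpan_of_mem_envelopingGrade hgr.lie_mem le_rfl
      (hP.ι_smul_mem_wordSpan hgr isHighestWeightVector_vermaVec) hu
      (mem_wordSpan_of_mem ⟨hk, x, hx, rfl⟩))

theorem isQuasifinite (hgr : IsLieGradation gr) {P Q : ℤ → Submodule ℂ L}
    (hP : IsSingularFamily lam P) (hQ : Q ≤ gr) (hQ_fg : ∀ k < 0, (Q k).FG)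
    (hPQ : ∀ k < 0, gr k ≤ Q k ⊔ P k) : IsQuasifinite gr lam := by
  let v : Irred gr lam := Submodule.Quotient.mk (vermaVec gr lam)
  have hv : IsHighestWeightVector lam v :=
    ⟨fun hj _ hx => congrArg Submodule.Quotient.mk (ι_smul_vermaVec_of_pos hj hx),
      fun h => congrArg Submodule.Quotient.mk (ι_smul_vermaVec_of_zero h)⟩
  have hvP : ∀ k < 0, ∀ x ∈ P k, ι ℂ x • v = 0 := fun k hk x hx =>
    (Submodule.Quotient.mk_eq_zero _).2 (hπ.ι_smul_vermaVec_mem_maxGradedSubmodule hgr hP hk hx)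
  have hvQ : ∀ k < 0, ∀ x ∈ gr k, ∃ q ∈ Q k, ι ℂ x • v = ι ℂ q • v := by
    intro k hk x hx
    obtain ⟨q, hq, y, hy, rfl⟩ := Submodule.mem_sup.1 (hPQ k hk hx)
    exact ⟨q, hq, by rw [map_add, add_smul, hvP k hk y hy, add_zero]⟩
  intro j
  have h_fg : (wordSpan Q (vectorSeed v) j).FG :=
    fg_wordSpan hQ_fg (fun i => (Set.finite_singleton v).subset fun _ hm => hm.2)
      (fun _ => vectorSeed_of_pos) j
  have h_le : irredGrade gr lam j ≤ wordSpan Q (vectorSeed v) j := by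
    rintro _ ⟨m, hm, rfl⟩
    obtain ⟨u, hu, rfl⟩ := mem_vermaGrade_iff.1 hm
    rw [← add_zero j]
    exact smul_mem_wordSpan_of_mem_envelopingGrade hgr.lie_mem hQ (hv.ι_smul_mem_wordSpan hvQ) hu
      mem_wordSpan_vectorSeed
  have := Module.Finite.iff_fg.2 h_fg
  exact Submodule.finiteDimensional_of_le h_le

theorem exists_weight_lie_eq_zero (hgr : IsLieGradation gr) (h_fin : IsQuasifinite gr lam)
    {k : ℤ} (hk : 0 < k) {V : Type*} [AddCommGroup V] [Module ℂ V]
    (hV : ¬ FiniteDimensional ℂ V) (F : V →ₗ[ℂ] L) (hF : ∀ a, F a ∈ gr (-k)) :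
    ∃ a ≠ 0, ∀ y ∈ gr k, ∀ z : gr 0, (z : L) = ⁅y, F a⁆ → lam z = 0 := by
  let T : V →ₗ[ℂ] irredGrade gr lam (-k) := LinearMap.codRestrict _
    ((maxGradedSubmodule gr lam).mkQ.restrictScalars ℂ ∘ₗ
      (lieAct ℂ L (Verma gr lam)).flip (vermaVec gr lam) ∘ₗ F)
    fun a => ⟨_, ι_smul_vermaVec_mem_vermaGrade (hF a), rfl⟩
  have := h_fin (-k)
  have hT : ¬ Function.Injective T := fun h_inj => hV (FiniteDimensional.of_injective T h_inj)
  rw [← LinearMap.ker_eq_bot] at hT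
  obtain ⟨a, ha, ha_zero⟩ := Submodule.exists_mem_ne_zero_of_ne_bot hT
  refine ⟨a, ha_zero, fun y hy z hz => ?_⟩
  have h_mem : ι ℂ (F a) • vermaVec gr lam ∈ maxGradedSubmodule gr lam :=
    (Submodule.Quotient.mk_eq_zero _).1 (congrArg Subtype.val (LinearMap.mem_ker.1 ha))
  have h_zero := hπ.map_eq_zero_of_mem_maxGradedSubmodule hgr (Submodule.smul_mem _ (ι ℂ y) h_mem)
  rwa [ι_smul_ι_smul, ι_smul_vermaVec_of_pos hk hy, smul_zero, zero_add, ← hz,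
    ι_smul_vermaVec_of_zero, map_smul, hπ.map_vermaVec, smul_eq_mul, mul_one] at h_zero

end IsHighestWeightCoeff

end Coefficient

end MaxGraded

/-! ### The gradation of `𝒟_p^±` -/

/-- The coefficient `f k` of the operator `∑ k, t ^ k (f k)(D)`. -/
noncomputable def coef (k : ℤ) : DiffOp →ₗ[ℂ] ℂ[X] := Finsupp.lapply k

theorem coef_mon (k j : ℤ) (f : ℂ[X]) : coef k (mon j f) = if j = k then f else 0 :=
  Finsupp.single_apply

theorem coef_mon_same (k : ℤ) (f : ℂ[X]) : coef k (mon k f) = f := by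
  rw [coef_mon, if_pos rfl]

theorem eq_sum_mon_coef (a : DiffOp) : a = ∑ k ∈ Finsupp.support a, mon k (coef k a) :=
  (Finsupp.sum_single a).symm

theorem mon_mul_mon_zero (k : ℤ) (f g : ℂ[X]) : mon k f * mon 0 g = mon k (f * g) := by
  rw [mon_mul_mon, add_zero, Int.cast_zero, C_0, add_zero, comp_X]

theorem coef_mul_mon_zero (a : DiffOp) (p : ℂ[X]) (k : ℤ) :
    coef k (a * mon 0 p) = coef k a * p := by
  induction a using induction_mon with
  | h0 => rw [zero_mul, map_zero, zero_mul]
  | hadd a b ha hb => rw [add_mul, map_add, map_add, ha, hb, add_mul]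
  | hmon j f => rw [mon_mul_mon_zero, coef_mon, coef_mon, ite_mul, zero_mul]

theorem coef_sigmaZero (p : ℂ[X]) (c : ℂ) (s : ℤˣ) (a : DiffOp) (k : ℤ) :
    coef k (sigmaZero p c s a) = ((-1) ^ p.natDegree * (((s ^ k : ℤˣ) : ℤ) : ℂ)) •
      (coef k a).comp (-X - C (k : ℂ) + C c) := by
  induction a using induction_mon with
  | h0 => simp only [map_zero, zero_comp, smul_zero]
  | hadd a b ha hb => rw [map_add, map_add, map_add, ha, hb, add_comp, smul_add]
  | hmon j f =>
    rw [sigmaZero_mon, map_smul, coef_mon, coef_mon]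
    split_ifs with h
    · rw [h]
    · rw [smul_zero, zero_comp, smul_zero]

/-- The condition `σ₀(t ^ k f(D)) = -t ^ k f(D)` on a polynomial `f`, which says that
`t ^ k f(D) p(D)` lies in `𝒟_p^±`. -/
def IsAntiInvariant (p : ℂ[X]) (c : ℂ) (s : ℤˣ) (k : ℤ) (f : ℂ[X]) : Prop :=
  ((-1) ^ p.natDegree * (((s ^ k : ℤˣ) : ℤ) : ℂ)) • f.comp (-X - C (k : ℂ) + C c) = -f

section Grading

variable {p : ℂ[X]} {c : ℂ} {s : ℤˣ} {hc : IsSymmetricAbout p c}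

variable (hc) in
theorem IsAntiInvariant.mon_mem_DpSub {k : ℤ} {f : ℂ[X]} (hf : IsAntiInvariant p c s k f) :
    mon k (f * p) ∈ DpSub p c s hc :=
  ⟨mon k f, (mon_mul_mon_zero k f p).symm, by
    rw [sigmaZero_mon, ← map_smul, hf, mon_mul_mon_zero, neg_mul, map_neg]⟩

theorem exists_coef_eq_of_mem_DpSub (hp : p ≠ 0) {d : DiffOp} (hd : d ∈ DpSub p c s hc) (k : ℤ) :
    ∃ f, IsAntiInvariant p c s k f ∧ coef k d = f * p := by
  obtain ⟨a, rfl, ha⟩ := hd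
  refine ⟨coef k a, mul_right_cancel₀ hp ?_, coef_mul_mon_zero a p k⟩
  have h := congrArg (coef k) ha
  rwa [coef_mul_mon_zero, coef_sigmaZero, map_neg, coef_mul_mon_zero, ← neg_mul] at h

theorem mon_coef_mem_DpSub (hp : p ≠ 0) {d : DiffOp} (hd : d ∈ DpSub p c s hc) (k : ℤ) :
    mon k (coef k d) ∈ DpSub p c s hc := by
  obtain ⟨f, hf, h⟩ := exists_coef_eq_of_mem_DpSub hp hd k
  exact h ▸ hf.mon_mem_DpSub hc

/-- The inclusion of `𝒟` as a subspace of its central extension. -/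
noncomputable def incl : DiffOp →ₗ[ℂ] DHat := LinearMap.inl ℂ DiffOp ℂ

/-- The inclusion `z ↦ z C` of the central line. -/
noncomputable def central : ℂ →ₗ[ℂ] DHat := LinearMap.inr ℂ DiffOp ℂ

theorem eq_incl_add_central (x : DHat) : x = incl x.1 + central x.2 :=
  (Prod.fst_add_snd x).symm

theorem incl_mon_mem_hatGrade (k : ℤ) (f : ℂ[X]) : incl (mon k f) ∈ hatGrade k :=
  ⟨⟨f, rfl⟩, fun _ => rfl⟩

theorem central_mem_hatGrade (z : ℂ) : central z ∈ hatGrade 0 :=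
  ⟨⟨0, (map_zero (mon 0)).symm⟩, fun h => absurd rfl h⟩

theorem eq_incl_mon_of_mem_hatGrade {k : ℤ} (hk : k ≠ 0) {x : DHat} (hx : x ∈ hatGrade k) :
    x = incl (mon k (coef k x.1)) := by
  obtain ⟨⟨f, hf⟩, hz⟩ := hx
  exact Prod.ext (by rw [hf, coef_mon_same]; rfl) (hz hk)

theorem lie_mem_hatGrade {i j : ℤ} {x y : DHat} (hx : x ∈ hatGrade i) (hy : y ∈ hatGrade j) :
    ⁅x, y⁆ ∈ hatGrade (i + j) := by
  obtain ⟨⟨f, hf⟩, -⟩ := hx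
  obtain ⟨⟨g, hg⟩, -⟩ := hy
  refine ⟨⟨f.comp (X + C (j : ℂ)) * g - g.comp (X + C (i : ℂ)) * f, ?_⟩, fun h => ?_⟩
  · rw [DHat.lie_def, hf, hg, lie_def, mon_mul_mon, mon_mul_mon, map_sub, add_comm j i]
  · rw [DHat.lie_def, hf, hg]
    exact (psi_mon i j f g).trans (if_neg h)

theorem lie_eq_zero_of_mem_hatGrade_zero {x y : DHat} (hx : x ∈ hatGrade 0)
    (hy : y ∈ hatGrade 0) : ⁅x, y⁆ = 0 := by
  obtain ⟨⟨f, hf⟩, -⟩ := hx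
  obtain ⟨⟨g, hg⟩, -⟩ := hy
  rw [DHat.lie_def, hf, hg, lie_def, mon_mul_mon_zero, mon_mul_mon_zero, mul_comm g f, sub_self,
    psi_mon, if_pos (add_zero 0), sub_eq_zero.2]
  · rfl
  · rw [neg_zero, Finset.Ico_self, Finset.sum_empty, Finset.sum_empty]

theorem iSupIndep_of_le_ker {ι R M W : Type*} [Ring R] [AddCommGroup M] [Module R M]
    [AddCommGroup W] [Module R W] {gr : ι → Submodule R M} (T : ι → M →ₗ[R] W)
    (h_ker : ∀ i j, j ≠ i → gr j ≤ LinearMap.ker (T i))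
    (h_disj : ∀ i, Disjoint (gr i) (LinearMap.ker (T i))) : iSupIndep gr :=
  fun i => (h_disj i).mono_right (iSup₂_le (h_ker i))

theorem iSupIndep_comap {ι R M M' : Type*} [Ring R] [AddCommGroup M] [Module R M]
    [AddCommGroup M'] [Module R M'] {gr : ι → Submodule R M'} (h_indep : iSupIndep gr)
    {f : M →ₗ[R] M'} (hf : Function.Injective f) : iSupIndep fun i => (gr i).comap f := by
  refine fun i => Submodule.disjoint_def.2 fun x hx hx' => hf ?_
  have h_le : ⨆ j, ⨆ _ : j ≠ i, (gr j).comap f ≤ (⨆ j, ⨆ _ : j ≠ i, gr j).comap f :=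
    iSup₂_le fun j hj => Submodule.comap_mono (le_iSup₂_of_le j hj le_rfl)
  rw [Submodule.disjoint_def.1 (h_indep i) (f x) hx (h_le hx'), map_zero]

theorem iSupIndep_hatGrade : iSupIndep hatGrade := by
  let T (k : ℤ) : DHat →ₗ[ℂ] ℂ[X] × ℂ := (coef k ∘ₗ LinearMap.fst ℂ DiffOp ℂ).prod
    (if k = 0 then LinearMap.snd ℂ DiffOp ℂ else 0)
  refine iSupIndep_of_le_ker T (fun k j hjk x => ?_) fun k => Submodule.disjoint_def.2 ?_
  · rintro ⟨⟨f, hf⟩, hz⟩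
    refine Prod.ext ((congrArg (coef k) hf).trans ((coef_mon k j f).trans (if_neg hjk))) ?_
    change (if k = 0 then LinearMap.snd ℂ DiffOp ℂ else 0) x = 0
    split_ifs with hk
    · exact hz (hk ▸ hjk)
    · rfl
  · rintro x ⟨⟨f, hf⟩, hz⟩ hT
    have hf0 : coef k x.1 = 0 := congrArg Prod.fst hT
    have hz0 : (if k = 0 then LinearMap.snd ℂ DiffOp ℂ else 0) x = 0 := congrArg Prod.snd hT
    rw [hf, coef_mon_same] at hf0
    refine Prod.ext (by rw [hf, hf0, map_zero]; rfl) ?_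
    by_cases hk : k = 0
    · rwa [if_pos hk] at hz0
    · exact hz hk

theorem iSup_grading (hp : p ≠ 0) : ⨆ k, grading p c s hc k = ⊤ := by
  refine eq_top_iff.2 ?_
  rintro ⟨x, hx⟩ -
  let y (k : ℤ) : DpHat p c s hc :=
    ⟨incl (mon k (coef k x.1)), mon_coef_mem_DpSub (hc := hc) hp hx k⟩
  let w : DpHat p c s hc := ⟨central x.2, (DpSub p c s hc).zero_mem⟩
  have h_sum : (⟨x, hx⟩ : DpHat p c s hc) = ∑ k ∈ Finsupp.support x.1, y k + w := by
    refine Subtype.ext ?_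
    change x = (DpHat p c s hc).toSubmodule.subtype (∑ k ∈ Finsupp.support x.1, y k + w)
    rw [map_add, map_sum]
    change x = ∑ k ∈ Finsupp.support x.1, incl (mon k (coef k x.1)) + central x.2
    rw [← map_sum, ← eq_sum_mon_coef]
    exact eq_incl_add_central x
  rw [h_sum]
  exact add_mem
    (sum_mem fun k _ => Submodule.mem_iSup_of_mem k (incl_mon_mem_hatGrade k _))
    (Submodule.mem_iSup_of_mem 0 (central_mem_hatGrade _))

theorem isLieGradation_grading (hp : p ≠ 0) : IsLieGradation (grading p c s hc) where
  lie_mem := lie_mem_hatGrade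
  independent := iSupIndep_comap iSupIndep_hatGrade Subtype.val_injective
  iSup_eq_top := iSup_grading hp

theorem exists_isHighestWeightCoeff_grading (hp : p ≠ 0)
    (lam : Module.Dual ℂ (grading p c s hc 0)) :
    ∃ π, IsHighestWeightCoeff (grading p c s hc) lam π := by
  refine exists_isHighestWeightCoeff (isLieGradation_grading hp) fun x hx y hy z hz => ?_
  have hz0 : (z : DpHat p c s hc) = 0 :=
    hz.trans (Subtype.ext (lie_eq_zero_of_mem_hatGrade_zero hx hy))
  rw [Submodule.coe_eq_zero.1 hz0, map_zero]

theorem exists_linearMap_extends (lam : Module.Dual ℂ (grading p c s hc 0)) :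
    ∃ μ : DHat →ₗ[ℂ] ℂ, ∀ h : grading p c s hc 0, μ (h : DpHat p c s hc) = lam h := by
  let i : grading p c s hc 0 →ₗ[ℂ] DHat :=
    (DpHat p c s hc).toSubmodule.subtype ∘ₗ (grading p c s hc 0).subtype
  have hi : Function.Injective i := Subtype.val_injective.comp Subtype.val_injective
  obtain ⟨g, hg⟩ := LinearMap.exists_leftInverse_of_injective i (LinearMap.ker_eq_bot.2 hi)
  exact ⟨lam ∘ₗ g, fun h => congrArg lam (LinearMap.congr_fun hg h)⟩

end Grading

/-! ### Generating series and quasipolynomials -/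

section GeneratingSeries

variable {K : Type*} [Field K]

/-- The operator `d/dx` on power series. -/
noncomputable def ddx : Module.End K (PowerSeries K) :=
  (PowerSeries.derivative K : PowerSeries K →ₗ[K] PowerSeries K)

theorem aeval_ddx_mul (q r : K[X]) (ψ : PowerSeries K) :
    aeval ddx (q * r) ψ = aeval ddx q (aeval ddx r ψ) := by
  rw [map_mul, Module.End.mul_apply]

/-- The exponential generating series `Γ(exp(x X)) = ∑ Γ(X ^ l) x ^ l / l!` of the moments of a
functional `Γ` on polynomials. -/
noncomputable def genSeries : (K[X] →ₗ[K] K) →ₗ[K] PowerSeries K where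
  toFun Γ := PowerSeries.mk fun l => Γ (X ^ l) / (l.factorial : K)
  map_add' Γ Γ' := by ext l; simp [add_div]
  map_smul' z Γ := by ext l; simp [mul_div_assoc]

theorem coeff_genSeries (Γ : K[X] →ₗ[K] K) (l : ℕ) :
    PowerSeries.coeff l (genSeries Γ) = Γ (X ^ l) / (l.factorial : K) :=
  PowerSeries.coeff_mk l fun l => Γ (X ^ l) / (l.factorial : K)

theorem genSeries_comp_neg (Γ : K[X] →ₗ[K] K) :
    genSeries (Γ ∘ₗ (aeval (-X : K[X])).toLinearMap) =
      PowerSeries.rescale (-1 : K) (genSeries Γ) := by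
  ext l
  have h_pow : (-X : K[X]) ^ l = ((-1 : K) ^ l) • X ^ l := by
    rw [neg_pow, smul_eq_C_mul, C_pow, C_neg, C_1]
  rw [PowerSeries.coeff_rescale, coeff_genSeries, coeff_genSeries, LinearMap.comp_apply,
    AlgHom.toLinearMap_apply, aeval_X_pow, h_pow, map_smul, smul_eq_mul, mul_div_assoc]

theorem rescale_neg_one_smul (z : K) (ψ : PowerSeries K) :
    PowerSeries.rescale (-1 : K) (z • ψ) = z • PowerSeries.rescale (-1 : K) ψ := by
  ext l
  rw [PowerSeries.coeff_rescale, map_smul, map_smul, PowerSeries.coeff_rescale, smul_eq_mul,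
    smul_eq_mul, mul_left_comm]

variable [CharZero K]

theorem aeval_ddx_X_pow_eq_zero_iff (n : ℕ) (ψ : PowerSeries K) :
    aeval ddx (X ^ n : K[X]) ψ = 0 ↔ ∀ l, n ≤ l → PowerSeries.coeff l ψ = 0 := by
  have h_coeff (l : ℕ) : PowerSeries.coeff l (aeval ddx (X ^ n : K[X]) ψ) =
      ((l + 1).ascFactorial n : K) * PowerSeries.coeff (l + n) ψ := by
    rw [aeval_X_pow, Module.End.pow_apply, ← PowerSeries.coeff_iterate_derivative]
    rfl
  have h_ne (l : ℕ) : ((l + 1).ascFactorial n : K) ≠ 0 :=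
    Nat.cast_ne_zero.2 (Nat.ascFactorial_pos _ _).ne'
  refine ⟨fun h l hl => ?_, fun h => PowerSeries.ext fun l => ?_⟩
  · rw [← Nat.sub_add_cancel hl]
    refine (mul_eq_zero.1 ((h_coeff (l - n)).symm.trans ?_)).resolve_left (h_ne _)
    rw [h, map_zero]
  · rw [h_coeff, h _ (Nat.le_add_left n l), mul_zero, map_zero]

theorem genSeries_injective : Function.Injective (genSeries (K := K)) := by
  refine fun Γ Γ' h => lhom_ext' fun l => LinearMap.ext_ring ?_
  have h_coeff := congrArg (PowerSeries.coeff l) h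
  rw [coeff_genSeries, coeff_genSeries, div_left_inj' (Nat.cast_ne_zero.2 l.factorial_ne_zero)]
    at h_coeff
  simpa only [LinearMap.comp_apply, monomial_one_right_eq_X_pow] using h_coeff

theorem genSeries_surjective : Function.Surjective (genSeries (K := K)) := by
  intro ψ
  refine ⟨(basisMonomials K).constr K fun l => (l.factorial : K) * PowerSeries.coeff l ψ,
    PowerSeries.ext fun l => ?_⟩
  have h_basis := (basisMonomials K).constr_basis K
    (fun l => (l.factorial : K) * PowerSeries.coeff l ψ) l
  simp only [coe_basisMonomials, monomial_one_right_eq_X_pow] at h_basis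
  rw [coeff_genSeries, h_basis, mul_div_cancel_left₀ _ (Nat.cast_ne_zero.2 l.factorial_ne_zero)]

theorem ddx_genSeries (Γ : K[X] →ₗ[K] K) :
    ddx (genSeries Γ) = genSeries (Γ ∘ₗ LinearMap.mulLeft K X) := by
  ext l
  have h_coeff : PowerSeries.coeff l (ddx (genSeries Γ)) =
      PowerSeries.coeff (l + 1) (genSeries Γ) * (l + 1) := PowerSeries.coeff_derivative _ _
  have hl : (l : K) + 1 ≠ 0 := Nat.cast_add_one_ne_zero l
  rw [h_coeff, coeff_genSeries, coeff_genSeries, LinearMap.comp_apply, LinearMap.mulLeft_apply,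
    ← pow_succ', Nat.factorial_succ, Nat.cast_mul, Nat.cast_succ]
  field_simp

theorem aeval_ddx_genSeries (q : K[X]) (Γ : K[X] →ₗ[K] K) :
    aeval ddx q (genSeries Γ) = genSeries (Γ ∘ₗ LinearMap.mulLeft K q) := by
  induction q using Polynomial.induction_on' generalizing Γ with
  | add q r hq hr =>
    rw [map_add, LinearMap.add_apply, hq, hr, ← map_add, ← LinearMap.comp_add]
    exact congrArg (fun f => genSeries (Γ ∘ₗ f)) (LinearMap.ext fun f => (add_mul q r f).symm)
  | monomial n z =>
    induction n generalizing Γ with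
    | zero =>
      rw [monomial_zero_left, aeval_C, Module.algebraMap_end_apply, ← map_smul]
      refine congrArg genSeries (LinearMap.ext fun f => ?_)
      rw [LinearMap.comp_apply, LinearMap.mulLeft_apply, ← smul_eq_C_mul, map_smul,
        LinearMap.smul_apply]
    | succ n ih =>
      rw [← monomial_mul_X, aeval_ddx_mul, aeval_X, ddx_genSeries, ih, LinearMap.comp_assoc,
        ← LinearMap.mulLeft_mul, X_mul]

theorem aeval_ddx_surjective {q : K[X]} (hq : q ≠ 0) :
    Function.Surjective (aeval (ddx (K := K)) q) := by
  intro ψ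
  obtain ⟨Γ, rfl⟩ := genSeries_surjective ψ
  obtain ⟨g, hg⟩ := LinearMap.exists_leftInverse_of_injective (LinearMap.mulLeft K q)
    (LinearMap.ker_eq_bot.2 (mul_right_injective₀ hq))
  exact ⟨genSeries (Γ ∘ₗ g), by
    rw [aeval_ddx_genSeries, LinearMap.comp_assoc, hg, LinearMap.comp_id]⟩

theorem map_mul_eq_zero_of_aeval_ddx {Γ : K[X] →ₗ[K] K} {B : K[X]}
    (h : aeval ddx B (genSeries Γ) = 0) (q : K[X]) : Γ (B * q) = 0 := by
  rw [aeval_ddx_genSeries, ← map_zero (genSeries (K := K))] at h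
  exact LinearMap.congr_fun (genSeries_injective h) q

theorem rescale_neg_one_aeval_ddx (q : K[X]) (ψ : PowerSeries K) :
    PowerSeries.rescale (-1 : K) (aeval ddx q ψ) =
      aeval ddx (q.comp (-X)) (PowerSeries.rescale (-1 : K) ψ) := by
  obtain ⟨Γ, rfl⟩ := genSeries_surjective ψ
  rw [aeval_ddx_genSeries, ← genSeries_comp_neg, ← genSeries_comp_neg, aeval_ddx_genSeries]
  refine congrArg genSeries (LinearMap.ext fun f => congrArg Γ ?_)
  change q * f.comp (-X) = (q.comp (-X) * f).comp (-X)
  rw [mul_comp, comp_assoc, neg_comp, X_comp, neg_neg, comp_X]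

theorem aeval_ddx_genSeries_add_rescale_eq_zero {Φ : K[X] →ₗ[K] K} {B : K[X]}
    (hB_even : B.comp (-X) = B) (hB : ∀ r, Φ (B * expand K 2 r) = 0) :
    aeval ddx B (genSeries Φ + PowerSeries.rescale (-1 : K) (genSeries Φ)) = 0 := by
  rw [← genSeries_comp_neg, ← map_add, aeval_ddx_genSeries, ← map_zero (genSeries (K := K))]
  refine congrArg genSeries (lhom_ext' fun l => LinearMap.ext_ring ?_)
  rw [LinearMap.comp_apply, monomial_one_right_eq_X_pow]
  change Φ (B * X ^ l) + Φ ((B * X ^ l).comp (-X)) = 0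
  rw [mul_comp, hB_even, X_pow_comp]
  rcases Nat.even_or_odd' l with ⟨m, rfl | rfl⟩
  · have h_even := hB (X ^ m)
    rw [map_pow, expand_X, ← pow_mul] at h_even
    rw [Even.neg_pow ⟨m, two_mul m⟩, h_even, add_zero]
  · rw [Odd.neg_pow ⟨m, rfl⟩, mul_neg, map_neg, add_neg_cancel]

end GeneratingSeries

theorem shiftedOp_eq_aeval_ddx (p : ℂ[X]) (c : ℂ) :
    shiftedOp p c = aeval ddx (taylor (c / 2) p) := by
  rw [taylor_apply, aeval_comp, shiftedOp, map_add, aeval_X, aeval_C,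
    Algebra.algebraMap_eq_smul_one]
  rfl

theorem coeff_expSeries (α : ℂ) (l : ℕ) :
    PowerSeries.coeff l (expSeries α) = α ^ l / (l.factorial : ℂ) := by
  rw [expSeries, PowerSeries.coeff_rescale, PowerSeries.coeff_exp, one_div, map_inv₀, map_natCast,
    div_eq_mul_inv]

theorem genSeries_leval (α : ℂ) : genSeries (leval α) = expSeries α := by
  ext l
  rw [coeff_genSeries, coeff_expSeries, leval_apply, eval_pow, eval_X]

theorem genSeries_comp_taylor (Γ : ℂ[X] →ₗ[ℂ] ℂ) (α : ℂ) :
    genSeries (Γ ∘ₗ taylor α) = expSeries α * genSeries Γ := by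
  ext l
  rw [coeff_genSeries, PowerSeries.coeff_mul, LinearMap.comp_apply, taylor_apply, X_pow_comp,
    add_comm, (Commute.all _ _).add_pow', map_sum, Finset.sum_div]
  refine Finset.sum_congr rfl fun ⟨i, j⟩ hij => ?_
  obtain rfl : i + j = l := Finset.HasAntidiagonal.mem_antidiagonal.1 hij
  have hi : (i.factorial : ℂ) ≠ 0 := Nat.cast_ne_zero.2 i.factorial_ne_zero
  have hj : (j.factorial : ℂ) ≠ 0 := Nat.cast_ne_zero.2 j.factorial_ne_zero
  have hij : ((i + j).factorial : ℂ) ≠ 0 := Nat.cast_ne_zero.2 (i + j).factorial_ne_zero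
  rw [coeff_expSeries, coeff_genSeries, ← C_pow, ← smul_eq_C_mul, map_nsmul, map_smul,
    nsmul_eq_mul, smul_eq_mul, Nat.cast_add_choose]
  field_simp

theorem expSeries_zero : expSeries 0 = 1 := by
  rw [expSeries, PowerSeries.rescale_zero_apply]; simp

theorem expSeries_add (α β : ℂ) : expSeries (α + β) = expSeries α * expSeries β := by
  rw [← genSeries_leval β, ← genSeries_comp_taylor, ← genSeries_leval]
  exact congrArg genSeries (LinearMap.ext fun f =>
    (congrArg (eval · f) (add_comm α β)).trans (taylor_eval α f β).symm)

theorem rescale_neg_one_expSeries (α : ℂ) :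
    PowerSeries.rescale (-1 : ℂ) (expSeries α) = expSeries (-α) := by
  rw [expSeries, expSeries, PowerSeries.rescale_rescale, mul_neg_one]

theorem aeval_ddx_mul_expSeries (q : ℂ[X]) (ψ : PowerSeries ℂ) (α : ℂ) :
    aeval ddx q (expSeries α * ψ) = expSeries α * aeval ddx (taylor α q) ψ := by
  obtain ⟨Γ, rfl⟩ := genSeries_surjective ψ
  rw [← genSeries_comp_taylor, aeval_ddx_genSeries, aeval_ddx_genSeries, ← genSeries_comp_taylor]
  exact congrArg genSeries (LinearMap.ext fun f => congrArg Γ (taylor_mul α q f))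

theorem aeval_ddx_X_sub_C_pow_expSeries_mul_eq_zero_iff (α : ℂ) (n : ℕ) (ψ : PowerSeries ℂ) :
    aeval ddx ((X - C α) ^ n) (expSeries α * ψ) = 0 ↔ ∀ l, n ≤ l → PowerSeries.coeff l ψ = 0 := by
  have h_unit : IsUnit (expSeries α) :=
    IsUnit.of_mul_eq_one (expSeries (-α)) (by rw [← expSeries_add, add_neg_cancel, expSeries_zero])
  rw [aeval_ddx_mul_expSeries, taylor_pow, map_sub, taylor_X, taylor_C, add_sub_cancel_right,
    h_unit.mul_right_eq_zero, aeval_ddx_X_pow_eq_zero_iff]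

theorem isQuasipolynomial_of_aeval_X_sub_C_pow_eq_zero {ψ : PowerSeries ℂ} {α : ℂ} {n : ℕ}
    (h : aeval ddx ((X - C α) ^ n) ψ = 0) : IsQuasipolynomial ψ := by
  obtain ⟨χ, rfl⟩ : ∃ χ, ψ = expSeries α * χ := ⟨expSeries (-α) * ψ, by
    rw [← mul_assoc, ← expSeries_add, add_neg_cancel, expSeries_zero, one_mul]⟩
  have hχ : χ = (χ.trunc n : ℂ[X]) := by
    ext l
    rw [coeff_coe, PowerSeries.coeff_trunc]
    split_ifs with hl
    · rfl
    · exact (aeval_ddx_X_sub_C_pow_expSeries_mul_eq_zero_iff α n χ).1 h l (not_lt.1 hl)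
  exact Submodule.subset_span ⟨χ.trunc n, α, by rw [← hχ, mul_comm]⟩

theorem IsQuasipolynomial.exists_aeval_ddx_eq_zero {ψ : PowerSeries ℂ} (h : IsQuasipolynomial ψ) :
    ∃ B : ℂ[X], B ≠ 0 ∧ aeval ddx B ψ = 0 := by
  induction h using Submodule.span_induction with
  | mem ψ h =>
    obtain ⟨q, α, rfl⟩ := h
    refine ⟨(X - C α) ^ (q.natDegree + 1), pow_ne_zero _ (X_sub_C_ne_zero α), ?_⟩
    rw [mul_comm, aeval_ddx_X_sub_C_pow_expSeries_mul_eq_zero_iff]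
    exact fun l hl => (coeff_coe q l).trans (coeff_eq_zero_of_natDegree_lt hl)
  | zero => exact ⟨1, one_ne_zero, map_zero _⟩
  | add φ ψ _ _ hφ hψ =>
    obtain ⟨B, hB, hBφ⟩ := hφ
    obtain ⟨D, hD, hDψ⟩ := hψ
    refine ⟨B * D, mul_ne_zero hB hD, ?_⟩
    rw [map_add, aeval_ddx_mul B D ψ, hDψ, mul_comm, aeval_ddx_mul, hBφ, map_zero, map_zero,
      add_zero]
  | smul z φ _ h =>
    obtain ⟨B, hB, hBφ⟩ := h
    exact ⟨B, hB, by rw [map_smul, hBφ, smul_zero]⟩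

theorem isQuasipolynomial_of_aeval_ddx_eq_zero {B : ℂ[X]} (hB : B ≠ 0) {ψ : PowerSeries ℂ}
    (h : aeval ddx B ψ = 0) : IsQuasipolynomial ψ := by
  induction B using UniqueFactorizationMonoid.induction_on_coprime generalizing ψ with
  | h0 => exact absurd rfl hB
  | @h1 u hu =>
    have hψ : aeval ddx ((X - C 0) ^ 0 : ℂ[X]) ψ = 0 := by
      obtain ⟨v, hv⟩ := hu.exists_left_inv
      rw [pow_zero, ← hv, aeval_ddx_mul, h, map_zero]
    exact isQuasipolynomial_of_aeval_X_sub_C_pow_eq_zero hψ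
  | @hpr q i hq =>
    obtain ⟨α, hα⟩ := IsAlgClosed.exists_root q (degree_pos_of_irreducible hq.irreducible).ne'
    have h_dvd : q ^ i ∣ (X - C α) ^ i := pow_dvd_pow_of_dvd
      ((irreducible_X_sub_C α).associated_of_dvd hq.irreducible (dvd_iff_isRoot.2 hα)).dvd' i
    obtain ⟨u, hu⟩ := h_dvd
    refine isQuasipolynomial_of_aeval_X_sub_C_pow_eq_zero (α := α) (n := i) ?_
    rw [hu, mul_comm, aeval_ddx_mul, h, map_zero]
  | @hcp q r hqr hq hr =>
    have h_sup : ψ ∈ LinearMap.ker (aeval ddx q) ⊔ LinearMap.ker (aeval ddx r) := by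
      rwa [sup_ker_aeval_eq_ker_aeval_mul_of_coprime ddx hqr.isCoprime]
    obtain ⟨φ, hφ, χ, hχ, rfl⟩ := Submodule.mem_sup.1 h_sup
    exact Submodule.add_mem _ (hq (left_ne_zero_of_mul hB) hφ) (hr (right_ne_zero_of_mul hB) hχ)

/-! ### The highest weight on brackets -/

theorem map_eq_zero_of_parity {K M : Type*} [Field K] [CharZero K] [AddCommGroup M] [Module K M]
    (A : K[X] →ₗ[K] M) {n : ℕ} (hA : ∀ l, Odd (l + n) → A (X ^ l) = 0) {q : K[X]}
    (hq : (-1 : K) ^ n • q.comp (-X) = -q) : A q = 0 := by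
  rw [q.as_sum_support_C_mul_X_pow, map_sum]
  refine Finset.sum_eq_zero fun l hl => ?_
  rw [← smul_eq_C_mul, map_smul, hA, smul_zero]
  by_contra h_even
  have h_neg : (-X : K[X]) = C (-1) * X := by rw [C_neg, C_1, neg_one_mul]
  have h_coeff := congrArg (coeff · l) hq
  simp only [h_neg, coeff_smul, comp_C_mul_X_coeff, coeff_neg, smul_eq_mul] at h_coeff
  rw [mul_left_comm, ← pow_add, add_comm n l, (Nat.not_odd_iff_even.1 h_even).neg_one_pow,
    mul_one] at h_coeff
  exact mem_support_iff.1 hl (self_eq_neg.1 h_coeff)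

/-- The functional `h ↦ Γ(h(X + 1/2) - h(X - 1/2)) + κ h(-(c + 1)/2)`. If `-Γ(h(X + c/2))` is the
highest weight of `h(D)` and `κ` that of `C`, it computes the highest weight of the bracket of
elements of degrees `1` and `-1`. -/
noncomputable def diffFunctional (c κ : ℂ) (Γ : ℂ[X] →ₗ[ℂ] ℂ) : ℂ[X] →ₗ[ℂ] ℂ :=
  Γ ∘ₗ taylor (1 / 2) - Γ ∘ₗ taylor (-(1 / 2)) + κ • leval (-((c + 1) / 2))

theorem genSeries_diffFunctional (c κ : ℂ) (Γ : ℂ[X] →ₗ[ℂ] ℂ) :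
    genSeries (diffFunctional c κ Γ) =
      genSeries Γ * twoSinhHalf + κ • expSeries (-((c + 1) / 2)) := by
  rw [diffFunctional, map_add, map_sub, map_smul, genSeries_comp_taylor, genSeries_comp_taylor,
    genSeries_leval, twoSinhHalf, mul_sub, mul_comm (expSeries _), mul_comm (expSeries _)]

theorem diffFunctional_taylor (c κ : ℂ) (Γ : ℂ[X] →ₗ[ℂ] ℂ) (z : ℂ) (h : ℂ[X]) :
    diffFunctional c κ Γ (taylor ((c + 1) / 2 + z) h) =
      Γ (taylor (c / 2 + (z + 1)) h) - Γ (taylor (c / 2 + z) h) + κ * h.eval z := by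
  simp only [diffFunctional, LinearMap.add_apply, LinearMap.sub_apply, LinearMap.comp_apply,
    LinearMap.smul_apply, taylor_taylor, leval_apply, taylor_eval, smul_eq_mul]
  ring_nf

theorem sum_range_diffFunctional_taylor (c κ : ℂ) (Γ : ℂ[X] →ₗ[ℂ] ℂ) (k : ℕ) (h : ℂ[X]) :
    ∑ i ∈ Finset.range k, diffFunctional c κ Γ (taylor ((c + 1) / 2 + (i : ℂ)) h) =
      Γ (taylor (c / 2 + k) h) - Γ (taylor (c / 2) h) +
        κ * ∑ i ∈ Finset.range k, h.eval (i : ℂ) := by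
  have h_telescope :=
    Finset.sum_range_sub (fun i : ℕ => Γ (taylor (c / 2 + (i : ℂ)) h)) k
  rw [Nat.cast_zero, add_zero] at h_telescope
  simp only [diffFunctional_taylor, Finset.sum_add_distrib, ← Finset.mul_sum, ← h_telescope,
    Nat.cast_succ]

theorem psi_mon_mon_neg (k : ℕ) (F G : ℂ[X]) :
    psi (mon k F) (mon (-k) G) =
      ∑ i ∈ Finset.range k, (taylor (-(k : ℂ)) F * G).eval (i : ℂ) := by
  rw [psi_mon, if_pos (add_neg_cancel _), neg_neg,
    Finset.Ico_eq_empty (Int.natCast_nonneg k).not_gt, Finset.sum_empty, sub_zero]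
  refine (Finset.sum_nbij' (fun i : ℕ => (i : ℤ) - k) (fun m => (m + k).toNat)
    ?_ ?_ ?_ ?_ fun i _ => ?_).symm
  · intro i hi; simp only [Finset.mem_range, Finset.mem_Ico] at hi ⊢; omega
  · intro m hm; simp only [Finset.mem_range, Finset.mem_Ico] at hm ⊢; omega
  · intro i _; omega
  · intro m hm; simp only [Finset.mem_Ico] at hm ⊢; omega
  · rw [eval_mul, taylor_eval, sub_add_cancel, Int.cast_sub, Int.cast_natCast, Int.cast_natCast,
      ← sub_eq_add_neg]

theorem lie_mon_mon (j k : ℤ) (F G : ℂ[X]) :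
    ⁅mon j F, mon k G⁆ = mon (j + k) (taylor (k : ℂ) F * G - taylor (j : ℂ) G * F) := by
  rw [lie_def, mon_mul_mon, mon_mul_mon, add_comm k j, ← map_sub, taylor_apply, taylor_apply]

theorem lie_incl_mon_mon_neg (k : ℕ) (F G : ℂ[X]) :
    ⁅incl (mon k F), incl (mon (-k) G)⁆ =
      incl (mon 0 (taylor (-(k : ℂ)) F * G - taylor (k : ℂ) (taylor (-(k : ℂ)) F * G))) +
      central (∑ i ∈ Finset.range k, (taylor (-(k : ℂ)) F * G).eval (i : ℂ)) := by
  rw [eq_incl_add_central ⁅incl (mon k F), incl (mon (-k) G)⁆]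
  congr 2
  · refine (lie_mon_mon k (-k) F G).trans ?_
    rw [add_neg_cancel, Int.cast_neg, Int.cast_natCast, taylor_mul, taylor_taylor, add_neg_cancel,
      taylor_zero, mul_comm F]
  · exact psi_mon_mon_neg k F G

section Weight

variable {p : ℂ[X]} {c : ℂ} {hc : IsSymmetricAbout p c} {s : ℤˣ} {μ : DHat →ₗ[ℂ] ℂ}
  {Γ : ℂ[X] →ₗ[ℂ] ℂ}

theorem map_labelOp_of_labelSeries_eq {lam : Module.Dual ℂ (grading p c s hc 0)}
    (hμ : ∀ h : grading p c s hc 0, μ (h : DpHat p c s hc) = lam h)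
    (hΓ : labelSeries p c s hc lam = shiftedOp p c (genSeries Γ)) (l : ℕ)
    (hl : Odd (l + p.natDegree)) : μ (labelOp p c l) = -Γ (taylor (c / 2) p * X ^ l) := by
  have h_coeff := congrArg (PowerSeries.coeff l) hΓ
  rw [shiftedOp_eq_aeval_ddx, aeval_ddx_genSeries, coeff_genSeries, labelSeries,
    PowerSeries.coeff_mk, dif_pos hl, ← hμ,
    div_left_inj' (Nat.cast_ne_zero.2 l.factorial_ne_zero)] at h_coeff
  exact neg_eq_iff_eq_neg.1 h_coeff

theorem isAntiInvariant_iff_taylor {k : ℤ} {f : ℂ[X]} :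
    IsAntiInvariant p c s k f ↔ ((-1) ^ p.natDegree * (((s ^ k : ℤˣ) : ℤ) : ℂ)) •
      (taylor ((c - k) / 2) f).comp (-X) = -taylor ((c - k) / 2) f := by
  have h_C : (C c : ℂ[X]) - C (k : ℂ) = C ((c - k) / 2) + C ((c - k) / 2) := by
    rw [← C_sub, ← C_add, add_halves]
  have h_taylor : taylor ((c - k) / 2) (f.comp (-X - C (k : ℂ) + C c)) =
      (taylor ((c - k) / 2) f).comp (-X) := by
    rw [taylor_apply, taylor_apply, comp_assoc, comp_assoc]
    congr 1
    simp only [add_comp, sub_comp, neg_comp, X_comp, C_comp]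
    linear_combination h_C
  rw [IsAntiInvariant, ← (taylor_injective ((c - k) / 2)).eq_iff, map_smul, map_neg, h_taylor]

theorem map_incl_mon_zero (hp : p ≠ 0)
    (hΓ : ∀ l, Odd (l + p.natDegree) → μ (labelOp p c l) = -Γ (taylor (c / 2) p * X ^ l))
    {F : ℂ[X]} (hF : mon 0 F ∈ DpSub p c s hc) : μ (incl (mon 0 F)) = -Γ (taylor (c / 2) F) := by
  obtain ⟨f, hf, h_coef⟩ := exists_coef_eq_of_mem_DpSub hp hF 0
  rw [coef_mon_same] at h_coef
  subst h_coef
  let A : ℂ[X] →ₗ[ℂ] ℂ :=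
    μ ∘ₗ incl ∘ₗ mon 0 ∘ₗ LinearMap.mulRight ℂ p ∘ₗ taylor (-(c / 2)) +
      Γ ∘ₗ LinearMap.mulLeft ℂ (taylor (c / 2) p)
  have hA (q : ℂ[X]) :
      A q = μ (incl (mon 0 (taylor (-(c / 2)) q * p))) + Γ (taylor (c / 2) p * q) := rfl
  have hA_odd (l : ℕ) (hl : Odd (l + p.natDegree)) : A (X ^ l) = 0 := by
    rw [hA, taylor_pow, taylor_X, C_neg, ← sub_eq_add_neg, ← neg_eq_iff_add_eq_zero,
      neg_eq_iff_eq_neg]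
    exact hΓ l hl
  have hf_parity : (-1 : ℂ) ^ p.natDegree • (taylor (c / 2) f).comp (-X) = -taylor (c / 2) f := by
    simpa only [zpow_zero, Units.val_one, Int.cast_one, mul_one, Int.cast_zero, sub_zero] using
      isAntiInvariant_iff_taylor.1 hf
  have h_zero := map_eq_zero_of_parity A hA_odd hf_parity
  rw [hA, taylor_taylor, neg_add_cancel, taylor_zero, mul_comm (taylor (c / 2) p),
    ← taylor_mul] at h_zero
  exact eq_neg_of_add_eq_zero_left h_zero

theorem map_lie_incl_mon_mon_neg (hp : p ≠ 0)
    (hΓ : ∀ l, Odd (l + p.natDegree) → μ (labelOp p c l) = -Γ (taylor (c / 2) p * X ^ l))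
    (k : ℕ) {F G : ℂ[X]} (hF : mon k F ∈ DpSub p c s hc) (hG : mon (-k) G ∈ DpSub p c s hc) :
    μ ⁅incl (mon k F), incl (mon (-k) G)⁆ = ∑ i ∈ Finset.range k,
      diffFunctional c (μ (central 1)) Γ
        (taylor ((c + 1) / 2 + (i : ℂ)) (taylor (-(k : ℂ)) F * G)) := by
  have h_lie : ⁅mon (k : ℤ) F, mon (-(k : ℤ)) G⁆ ∈ DpSub p c s hc := (DpSub p c s hc).lie_mem hF hG
  have h_fst := congrArg Prod.fst (lie_incl_mon_mon_neg k F G)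
  rw [lie_incl_mon_mon_neg, sum_range_diffFunctional_taylor]
  set H := taylor (-(k : ℂ)) F * G
  have h_mem : mon 0 (H - taylor (k : ℂ) H) ∈ DpSub p c s hc := by
    have h_eq : ⁅mon (k : ℤ) F, mon (-(k : ℤ)) G⁆ = mon 0 (H - taylor (k : ℂ) H) :=
      h_fst.trans (add_zero _)
    exact h_eq ▸ h_lie
  have h_central (z : ℂ) : μ (central z) = μ (central 1) * z := by
    rw [mul_comm, ← smul_eq_mul, ← map_smul, ← map_smul, smul_eq_mul, mul_one]
  rw [map_add, map_incl_mon_zero hp hΓ h_mem, h_central, map_sub, map_sub, taylor_taylor, neg_sub]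

end Weight

/-! ### Sufficiency -/

theorem exists_fg_le_sup_inf {K V : Type*} [DivisionRing K] [AddCommGroup V] [Module K V]
    (A : Submodule K V) {N : Submodule K V} (hN : N.CoFG) : ∃ Q ≤ A, Q.FG ∧ A ≤ Q ⊔ (A ⊓ N) := by
  obtain ⟨Q, h_disj, h_sup⟩ := IsModularLattice.exists_disjoint_and_sup_eq (inf_le_left : A ⊓ N ≤ A)
  have hQA : Q ≤ A := h_sup ▸ le_sup_right
  refine ⟨Q, hQA, hN.fg_of_disjoint (disjoint_iff_inf_le.2 ?_), (sup_comm Q _).trans h_sup |>.ge⟩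
  exact fun x hx => h_disj.le_bot ⟨⟨hQA hx.1, hx.2⟩, hx.1⟩

section ShiftProd

variable {R : Type*} [CommRing R]

theorem taylor_dvd_taylor {f g : R[X]} (r : R) (h : f ∣ g) : taylor r f ∣ taylor r g :=
  _root_.map_dvd (taylorAlgHom r) h

/-- The product `∏ i < k, b(X - i)`. Multiples of it in degree `-k` stay divisible by the product
for `k - j` under brackets with elements of degree `j`. -/
noncomputable def shiftProd (b : R[X]) (k : ℕ) : R[X] :=
  ∏ i ∈ Finset.range k, taylor (-(i : R)) b

theorem shiftProd_ne_zero [IsDomain R] {b : R[X]} (hb : b ≠ 0) (k : ℕ) : shiftProd b k ≠ 0 :=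
  Finset.prod_ne_zero_iff.2 fun _ _ => (taylor_eq_zero _ _).not.2 hb

theorem shiftProd_dvd_shiftProd_add (b : R[X]) (m j : ℕ) : shiftProd b m ∣ shiftProd b (m + j) := by
  rw [shiftProd, shiftProd, Finset.prod_range_add]
  exact dvd_mul_right _ _

theorem shiftProd_dvd_taylor_shiftProd_add (b : R[X]) (m j : ℕ) :
    shiftProd b m ∣ taylor (j : R) (shiftProd b (m + j)) := by
  rw [add_comm m j, shiftProd, shiftProd, Finset.prod_range_add, taylor_mul]
  refine Dvd.dvd.mul_left (dvd_of_eq ?_) _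
  refine Eq.trans (Finset.prod_congr rfl fun i _ => ?_) (map_prod (taylorAlgHom (j : R)) _ _).symm
  change _ = taylor (j : R) (taylor _ b)
  rw [taylor_taylor, Nat.cast_add, neg_add, add_neg_cancel_left]

theorem dvd_taylor_shiftProd (b : R[X]) {k i : ℕ} (hi : i < k) :
    b ∣ taylor (i : R) (shiftProd b k) := by
  have h_factor : taylor (-(i : R)) b ∣ shiftProd b k :=
    Finset.dvd_prod_of_mem _ (Finset.mem_range.2 hi)
  have h := taylor_dvd_taylor (i : R) h_factor
  rwa [taylor_taylor, add_neg_cancel, taylor_zero] at h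

end ShiftProd

section DivisiblePart

variable {p : ℂ[X]} {c : ℂ} {s : ℤˣ} {hc : IsSymmetricAbout p c}

variable (p c s hc) in
/-- The elements `t ^ k f(D)` of degree `k` for which `f` is divisible by `∏ i < |k|, b(X - i)`. -/
noncomputable def divisiblePart (b : ℂ[X]) (k : ℤ) : Submodule ℂ (DpHat p c s hc) :=
  grading p c s hc k ⊓
    LinearMap.ker ((AdjoinRoot.mkₐ (shiftProd b k.natAbs)).toLinearMap ∘ₗ coef k ∘ₗ
      proj.toLinearMap ∘ₗ (DpHat p c s hc).toSubmodule.subtype)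

theorem mem_divisiblePart {b : ℂ[X]} {k : ℤ} {x : DpHat p c s hc} :
    x ∈ divisiblePart p c s hc b k ↔
      x ∈ grading p c s hc k ∧ shiftProd b k.natAbs ∣ coef k x.1.1 :=
  and_congr_right' AdjoinRoot.mk_eq_zero

theorem exists_fg_grading_le_sup_divisiblePart {b : ℂ[X]} (hb : b ≠ 0) (k : ℤ) :
    ∃ Q ≤ grading p c s hc k, Q.FG ∧ grading p c s hc k ≤ Q ⊔ divisiblePart p c s hc b k := by
  have := (AdjoinRoot.powerBasis (shiftProd_ne_zero hb k.natAbs)).finite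
  exact exists_fg_le_sup_inf _ (Submodule.CoFG.ker _)

theorem lie_mem_divisiblePart (b : ℂ[X]) {j k : ℤ} (hj : 0 ≤ j) (hjk : j + k < 0)
    {y x : DpHat p c s hc} (hy : y ∈ grading p c s hc j) (hx : x ∈ divisiblePart p c s hc b k) :
    ⁅y, x⁆ ∈ divisiblePart p c s hc b (j + k) := by
  obtain ⟨hx_mem, hx_dvd⟩ := mem_divisiblePart.1 hx
  refine mem_divisiblePart.2 ⟨lie_mem_hatGrade hy hx_mem, ?_⟩
  obtain ⟨⟨F, hF : y.1.1 = mon j F⟩, -⟩ := hy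
  obtain ⟨⟨G, hG : x.1.1 = mon k G⟩, -⟩ := hx_mem
  obtain ⟨i, rfl⟩ := Int.eq_ofNat_of_zero_le hj
  obtain ⟨m, rfl⟩ : ∃ m : ℕ, k = -((m + i : ℕ) : ℤ) := ⟨(-(i + k)).toNat, by omega⟩
  rw [hG, coef_mon_same, Int.natAbs_neg, Int.natAbs_natCast] at hx_dvd
  change _ ∣ coef _ ⁅y.1.1, x.1.1⁆
  rw [hF, hG, lie_mon_mon, coef_mon_same, show (i + -((m + i : ℕ) : ℤ)).natAbs = m by omega]
  refine dvd_sub (Dvd.dvd.mul_left ((shiftProd_dvd_shiftProd_add b m i).trans hx_dvd) _)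
    (Dvd.dvd.mul_right ?_ _)
  exact (shiftProd_dvd_taylor_shiftProd_add b m i).trans (taylor_dvd_taylor _ hx_dvd)

theorem map_lie_eq_zero_of_shiftProd_dvd (hp : p ≠ 0) {μ : DHat →ₗ[ℂ] ℂ} {Γ : ℂ[X] →ₗ[ℂ] ℂ}
    (hΓ : ∀ l, Odd (l + p.natDegree) → μ (labelOp p c l) = -Γ (taylor (c / 2) p * X ^ l))
    {B : ℂ[X]} (hB : ∀ q, diffFunctional c (μ (central 1)) Γ (B * q) = 0) (k : ℕ) {F G : ℂ[X]}
    (hF : mon k F ∈ DpSub p c s hc) (hG : mon (-k) G ∈ DpSub p c s hc)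
    (h_dvd : shiftProd (taylor (-((c + 1) / 2)) B) k ∣ G) :
    μ ⁅incl (mon k F), incl (mon (-k) G)⁆ = 0 := by
  rw [map_lie_incl_mon_mon_neg hp hΓ k hF hG]
  refine Finset.sum_eq_zero fun i hi => ?_
  have h_shift := taylor_dvd_taylor ((c + 1) / 2)
    ((dvd_taylor_shiftProd _ (Finset.mem_range.1 hi)).trans (taylor_dvd_taylor (i : ℂ) h_dvd))
  rw [taylor_taylor, taylor_taylor, add_neg_cancel, taylor_zero] at h_shift
  obtain ⟨q, hq⟩ := h_shift
  rw [taylor_mul, hq, mul_left_comm, hB]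

theorem isSingularFamily_divisiblePart {lam : Module.Dual ℂ (grading p c s hc 0)} (hp : p ≠ 0)
    {μ : DHat →ₗ[ℂ] ℂ} (hμ : ∀ h : grading p c s hc 0, μ (h : DpHat p c s hc) = lam h)
    {Γ : ℂ[X] →ₗ[ℂ] ℂ}
    (hΓ : ∀ l, Odd (l + p.natDegree) → μ (labelOp p c l) = -Γ (taylor (c / 2) p * X ^ l))
    {B : ℂ[X]} (hB : ∀ q, diffFunctional c (μ (central 1)) Γ (B * q) = 0) :
    IsSingularFamily lam (divisiblePart p c s hc (taylor (-((c + 1) / 2)) B)) where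
  le _ := inf_le_left
  lie_mem hj hjk _ _ hy hx := lie_mem_divisiblePart _ hj hjk hy hx
  weight_lie := by
    intro j hj y x hy hx z hz
    obtain ⟨hx_mem, hx_dvd⟩ := mem_divisiblePart.1 hx
    obtain ⟨k, rfl⟩ := Int.eq_ofNat_of_zero_le hj.le
    have hy_eq := eq_incl_mon_of_mem_hatGrade hj.ne' hy
    have hx_eq := eq_incl_mon_of_mem_hatGrade (neg_ne_zero.2 hj.ne') hx_mem
    rw [Int.natAbs_neg, Int.natAbs_natCast] at hx_dvd
    rw [← hμ, hz]
    refine (congrArg₂ (fun u v : DHat => μ ⁅u, v⁆) hy_eq hx_eq).trans ?_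
    exact map_lie_eq_zero_of_shiftProd_dvd (hc := hc) hp hΓ hB k (mon_coef_mem_DpSub hp y.2 _)
      (mon_coef_mem_DpSub hp x.2 _) hx_dvd

end DivisiblePart

theorem isQuasifinite_of_labelSeries {p : ℂ[X]} {c : ℂ} {hc : IsSymmetricAbout p c} {s : ℤˣ}
    {lam : Module.Dual ℂ (grading p c s hc 0)} (hp : p ≠ 0) {G : PowerSeries ℂ}
    (hG_quasi : IsQuasipolynomial (G * twoSinhHalf))
    (hG : labelSeries p c s hc lam = shiftedOp p c G) :
    IsQuasifinite (grading p c s hc) lam := by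
  obtain ⟨π, hπ⟩ := exists_isHighestWeightCoeff_grading hp lam
  obtain ⟨Γ, rfl⟩ := genSeries_surjective G
  obtain ⟨μ, hμ⟩ := exists_linearMap_extends lam
  have h_exp : IsQuasipolynomial (expSeries (-((c + 1) / 2))) :=
    Submodule.subset_span ⟨1, _, by rw [coe_one, one_mul]⟩
  obtain ⟨B, hB, hBΓ⟩ := IsQuasipolynomial.exists_aeval_ddx_eq_zero
    (Submodule.add_mem _ hG_quasi (Submodule.smul_mem _ (μ (central 1)) h_exp))
  rw [← genSeries_diffFunctional] at hBΓ
  choose Q hQ_le hQ_fg hQ using exists_fg_grading_le_sup_divisiblePart (p := p) (hc := hc) (s := s)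
    ((taylor_eq_zero (-((c + 1) / 2)) B).not.2 hB)
  exact hπ.isQuasifinite (isLieGradation_grading hp)
    (isSingularFamily_divisiblePart hp hμ (map_labelOp_of_labelSeries_eq hμ hG)
      (map_mul_eq_zero_of_aeval_ddx hBΓ)) hQ_le (fun k _ => hQ_fg k) fun k _ => hQ k

/-! ### Necessity -/

theorem expand_two_comp_neg_X {R : Type*} [CommRing R] (u : R[X]) :
    (expand R 2 u).comp (-X) = expand R 2 u := by
  rw [expand_eq_comp_X_pow, comp_assoc, X_pow_comp, neg_sq]

theorem IsSymmetricAbout.taylor_comp_neg_X {p : ℂ[X]} {c : ℂ} (hc : IsSymmetricAbout p c) (a : ℂ) :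
    (taylor (c / 2 + a) p).comp (-X) = (-1 : ℂ) ^ p.natDegree • taylor (c / 2 - a) p := by
  have h_C : (C c : ℂ[X]) = C (c / 2) + C (c / 2) := by rw [← C_add, add_halves]
  conv_lhs => rw [show p = (-1) ^ p.natDegree * p.comp (-X + C c) from hc]
  simp only [taylor_apply, mul_comp, pow_comp, neg_comp, one_comp, comp_assoc, add_comp, X_comp,
    C_comp, smul_eq_C_mul, C_pow, C_neg, C_1]
  congr 2
  rw [C_add, C_sub, h_C]
  ring

theorem rescale_neg_one_twoSinhHalf :
    PowerSeries.rescale (-1 : ℂ) twoSinhHalf = -twoSinhHalf := by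
  rw [twoSinhHalf, map_sub, rescale_neg_one_expSeries, rescale_neg_one_expSeries, neg_neg, neg_sub]

theorem constantCoeff_twoSinhHalf : PowerSeries.constantCoeff twoSinhHalf = 0 := by
  rw [twoSinhHalf, map_sub, ← PowerSeries.coeff_zero_eq_constantCoeff_apply,
    ← PowerSeries.coeff_zero_eq_constantCoeff_apply, coeff_expSeries, coeff_expSeries, pow_zero,
    pow_zero, sub_self]

/-- The elements `t ^ k f(D) p(D)` with `f(x + (c - k)/2) = x ^ e u(x ^ 2)`, parametrized by `u`.
For the right parity of `e` they lie in `𝒟_p^±`. -/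
noncomputable def parityFamily (p : ℂ[X]) (c : ℂ) (e : ℕ) (k : ℤ) : ℂ[X] →ₗ[ℂ] DHat :=
  incl ∘ₗ mon k ∘ₗ LinearMap.mulRight ℂ p ∘ₗ taylor (-((c - k) / 2)) ∘ₗ
    LinearMap.mulLeft ℂ (X ^ e) ∘ₗ (expand ℂ 2).toLinearMap

theorem exists_sign_mul_neg_one_pow_eq_neg_one (n : ℕ) (s : ℤˣ) :
    ∃ e : ℕ, ((-1) ^ n * ((s : ℤ) : ℂ)) * (-1) ^ e = -1 := by
  rcases Int.units_eq_one_or s with rfl | rfl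
  · exact ⟨n + 1, by rw [Units.val_one, Int.cast_one, mul_one, ← pow_add,
      Odd.neg_one_pow ⟨n, by ring⟩]⟩
  · exact ⟨n, by rw [Units.val_neg, Units.val_one, Int.cast_neg, Int.cast_one, mul_neg_one,
      neg_mul, ← pow_add, Even.neg_one_pow ⟨n, rfl⟩]⟩

section Necessity

variable {p : ℂ[X]} {c : ℂ} {s : ℤˣ} {hc : IsSymmetricAbout p c}

theorem isAntiInvariant_taylor_X_pow_mul_expand {e : ℕ}
    (he : ((-1) ^ p.natDegree * ((s : ℤ) : ℂ)) * (-1) ^ e = -1) {k : ℤ} (hk : s ^ k = s)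
    (u : ℂ[X]) : IsAntiInvariant p c s k (taylor (-((c - k) / 2)) (X ^ e * expand ℂ 2 u)) := by
  have h_neg : (-X : ℂ[X]) ^ e = (-1 : ℂ) ^ e • X ^ e := by
    rw [neg_pow, smul_eq_C_mul, C_pow, C_neg, C_1]
  rw [isAntiInvariant_iff_taylor, taylor_taylor, add_neg_cancel, taylor_zero, mul_comp,
    X_pow_comp, expand_two_comp_neg_X, hk, h_neg, smul_mul_assoc, smul_smul, he, neg_one_smul]

theorem rescale_neg_one_labelSeries (lam : Module.Dual ℂ (grading p c s hc 0)) :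
    PowerSeries.rescale (-1 : ℂ) (labelSeries p c s hc lam) =
      -(-1 : ℂ) ^ p.natDegree • labelSeries p c s hc lam := by
  ext l
  rw [PowerSeries.coeff_rescale, map_smul, smul_eq_mul, labelSeries, PowerSeries.coeff_mk]
  split_ifs with hl
  · congr 1
    have h_sign : (-1 : ℂ) ^ l * (-1) ^ p.natDegree = -1 := by rw [← pow_add, hl.neg_one_pow]
    have h_sq : (-1 : ℂ) ^ p.natDegree * (-1) ^ p.natDegree = 1 := by
      rw [← pow_add, Even.neg_one_pow ⟨_, rfl⟩]
    linear_combination (-1 : ℂ) ^ p.natDegree * h_sign - (-1 : ℂ) ^ l * h_sq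
  · rw [mul_zero, mul_zero]

theorem exists_odd_preimage_labelSeries (hp : p ≠ 0)
    (lam : Module.Dual ℂ (grading p c s hc 0)) :
    ∃ G : PowerSeries ℂ, labelSeries p c s hc lam = shiftedOp p c G ∧
      PowerSeries.rescale (-1 : ℂ) G = -G := by
  set P : ℂ[X] := taylor (c / 2) p with hP
  obtain ⟨G, hG⟩ := aeval_ddx_surjective ((taylor_eq_zero (c / 2) p).not.2 hp)
    (labelSeries p c s hc lam)
  have hP_neg : P = (-1 : ℂ) ^ p.natDegree • P.comp (-X) := by
    have h := hc.taylor_comp_neg_X 0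
    rw [add_zero, sub_zero] at h
    rw [hP, h, smul_smul, ← pow_add, Even.neg_one_pow ⟨_, rfl⟩, one_smul]
  have hG_neg : aeval ddx P (PowerSeries.rescale (-1 : ℂ) G) = -labelSeries p c s hc lam := by
    rw [hP_neg, map_smul, LinearMap.smul_apply, ← rescale_neg_one_aeval_ddx, hG,
      rescale_neg_one_labelSeries, smul_smul, mul_neg, ← pow_add, Even.neg_one_pow ⟨_, rfl⟩,
      neg_one_smul]
  refine ⟨(1 / 2 : ℂ) • (G - PowerSeries.rescale (-1 : ℂ) G), ?_, ?_⟩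
  · rw [shiftedOp_eq_aeval_ddx, map_smul, map_sub, hG_neg, hG, sub_neg_eq_add, ← two_smul ℂ,
      smul_smul, one_div_mul_cancel two_ne_zero, one_smul]
  · rw [rescale_neg_one_smul, map_sub, PowerSeries.rescale_rescale, neg_mul_neg, one_mul,
      PowerSeries.rescale_one, RingHom.id_apply, ← smul_neg, neg_sub]

theorem map_lie_parityFamily (hp : p ≠ 0) (hc : IsSymmetricAbout p c) {μ : DHat →ₗ[ℂ] ℂ}
    {Γ : ℂ[X] →ₗ[ℂ] ℂ}
    (hΓ : ∀ l, Odd (l + p.natDegree) → μ (labelOp p c l) = -Γ (taylor (c / 2) p * X ^ l)) {e : ℕ}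
    (he : ((-1) ^ p.natDegree * ((s : ℤ) : ℂ)) * (-1) ^ e = -1) (r u : ℂ[X]) :
    μ ⁅parityFamily p c e 1 r, parityFamily p c e (-1) u⁆ =
      diffFunctional c (μ (central 1)) Γ (taylor (c / 2 + 1 / 2) p * taylor (c / 2 - 1 / 2) p *
        expand ℂ 2 (X ^ e * u) * expand ℂ 2 r) := by
  have h_pos := (isAntiInvariant_taylor_X_pow_mul_expand (c := c) he
    (zpow_one s) r).mon_mem_DpSub hc
  have h_neg := (isAntiInvariant_taylor_X_pow_mul_expand (c := c) he (k := -1)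
    (by rw [zpow_neg_one, Int.units_inv_eq_self]) u).mon_mem_DpSub hc
  have h_lie := map_lie_incl_mon_mon_neg hp hΓ 1 (Nat.cast_one (R := ℤ) ▸ h_pos)
    (Nat.cast_one (R := ℤ) ▸ h_neg)
  simp only [Nat.cast_one, Finset.sum_range_one, Nat.cast_zero, add_zero] at h_lie
  refine h_lie.trans (congrArg _ ?_)
  have h_expand : expand ℂ 2 (X ^ e * u) * expand ℂ 2 r =
      (X ^ e * expand ℂ 2 r) * (X ^ e * expand ℂ 2 u) := by
    rw [map_mul, map_pow, expand_X]
    ring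
  rw [mul_assoc, h_expand]
  generalize X ^ e * expand ℂ 2 r = a
  generalize X ^ e * expand ℂ 2 u = b
  simp only [taylor_mul, taylor_taylor]
  rw [Int.cast_neg, Int.cast_one, show (c + 1) / 2 + (-1 + -((c - 1) / 2)) = 0 by ring,
    show (c + 1) / 2 + -((c - -1) / 2) = 0 by ring, taylor_zero, taylor_zero,
    show (c + 1) / 2 + -1 = c / 2 - 1 / 2 by ring, show (c + 1) / 2 = c / 2 + 1 / 2 by ring]
  ring

/-- Infinitely many elements of degree `-1` meet a finite-dimensional component of the module, so
one of them kills the highest weight vector. -/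
theorem exists_even_mul_expand_diffFunctional_eq_zero
    {lam : Module.Dual ℂ (grading p c s hc 0)} (hp : p ≠ 0) {μ : DHat →ₗ[ℂ] ℂ}
    (hμ : ∀ h : grading p c s hc 0, μ (h : DpHat p c s hc) = lam h) {Γ : ℂ[X] →ₗ[ℂ] ℂ}
    (hΓ : ∀ l, Odd (l + p.natDegree) → μ (labelOp p c l) = -Γ (taylor (c / 2) p * X ^ l))
    (h_fin : IsQuasifinite (grading p c s hc) lam) :
    ∃ B : ℂ[X], B ≠ 0 ∧ B.comp (-X) = B ∧
      ∀ r, diffFunctional c (μ (central 1)) Γ (B * expand ℂ 2 r) = 0 := by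
  obtain ⟨π, hπ⟩ := exists_isHighestWeightCoeff_grading hp lam
  have hgr := isLieGradation_grading (s := s) (hc := hc) hp
  obtain ⟨e, he⟩ := exists_sign_mul_neg_one_pow_eq_neg_one p.natDegree s
  have h_mem {k : ℤ} (hk : s ^ k = s) (u : ℂ[X]) : parityFamily p c e k u ∈ DpHat p c s hc :=
    (isAntiInvariant_taylor_X_pow_mul_expand he hk u).mon_mem_DpSub hc
  let F : ℂ[X] →ₗ[ℂ] DpHat p c s hc := LinearMap.codRestrict (DpHat p c s hc).toSubmodule
    (parityFamily p c e (-1)) (h_mem (by rw [zpow_neg_one, Int.units_inv_eq_self]))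
  have hF (u : ℂ[X]) : F u ∈ grading p c s hc (-1) := incl_mon_mem_hatGrade (-1) _
  obtain ⟨u, hu_ne, hu⟩ :=
    hπ.exists_weight_lie_eq_zero hgr h_fin one_pos Polynomial.not_finite F hF
  refine ⟨taylor (c / 2 + 1 / 2) p * taylor (c / 2 - 1 / 2) p * expand ℂ 2 (X ^ e * u),
    ?_, ?_, fun r => ?_⟩
  · exact mul_ne_zero (mul_ne_zero ((taylor_eq_zero _ _).not.2 hp) ((taylor_eq_zero _ _).not.2 hp))
      ((expand_ne_zero two_pos).2 (mul_ne_zero (pow_ne_zero _ X_ne_zero) hu_ne))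
  · rw [mul_comp, mul_comp, expand_two_comp_neg_X, hc.taylor_comp_neg_X, sub_eq_add_neg,
      hc.taylor_comp_neg_X, smul_mul_smul_comm, ← pow_add, Even.neg_one_pow ⟨_, rfl⟩, one_smul,
      sub_neg_eq_add, ← sub_eq_add_neg, mul_comm (taylor (c / 2 - 1 / 2) p)]
  · let y : DpHat p c s hc := ⟨parityFamily p c e 1 r, h_mem (zpow_one s) r⟩
    have hy : y ∈ grading p c s hc 1 := incl_mon_mem_hatGrade 1 _
    have h_lie : ⁅y, F u⁆ ∈ grading p c s hc 0 := add_neg_cancel (1 : ℤ) ▸ hgr.lie_mem hy (hF u)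
    rw [← map_lie_parityFamily hp hc hΓ he]
    exact (hμ ⟨⁅y, F u⁆, h_lie⟩).trans (hu y hy _ rfl)

end Necessity

/-- The even part of `genSeries (diffFunctional c κ Γ)` is the given series up to exponentials, as
`κ exp(-(c + 1)x/2)` is the only part that is not even. -/
theorem isQuasipolynomial_genSeries_mul_twoSinhHalf {c κ : ℂ} {Γ : ℂ[X] →ₗ[ℂ] ℂ}
    (h_even : IsEvenSeries (genSeries Γ * twoSinhHalf)) {B : ℂ[X]} (hB_ne : B ≠ 0)
    (hB_even : B.comp (-X) = B) (hB : ∀ r, diffFunctional c κ Γ (B * expand ℂ 2 r) = 0) :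
    IsQuasipolynomial (genSeries Γ * twoSinhHalf) := by
  have h_quasi := isQuasipolynomial_of_aeval_ddx_eq_zero hB_ne
    (aeval_ddx_genSeries_add_rescale_eq_zero hB_even hB)
  have h_exp (α : ℂ) : IsQuasipolynomial (κ • expSeries α) :=
    Submodule.smul_mem _ κ (Submodule.subset_span ⟨1, α, by rw [coe_one, one_mul]⟩)
  rw [genSeries_diffFunctional, map_add, h_even, rescale_neg_one_smul, rescale_neg_one_expSeries]
    at h_quasi
  have h_two := Submodule.sub_mem _ h_quasi (Submodule.add_mem _ (h_exp (-((c + 1) / 2)))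
    (h_exp (- -((c + 1) / 2))))
  rw [add_add_add_comm, add_sub_cancel_right, ← two_smul ℂ] at h_two
  exact (Submodule.smul_mem_iff _ two_ne_zero).1 h_two

theorem exists_quasipolynomial_of_isQuasifinite {p : ℂ[X]} {c : ℂ} {s : ℤˣ}
    {hc : IsSymmetricAbout p c} {lam : Module.Dual ℂ (grading p c s hc 0)} (hp : p ≠ 0)
    (h_fin : IsQuasifinite (grading p c s hc) lam) :
    ∃ G : PowerSeries ℂ, IsQuasipolynomial (G * twoSinhHalf) ∧ IsEvenSeries (G * twoSinhHalf) ∧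
      labelSeries p c s hc lam = shiftedOp p c G := by
  obtain ⟨G, hG, hG_odd⟩ := exists_odd_preimage_labelSeries hp lam
  obtain ⟨Γ, rfl⟩ := genSeries_surjective G
  obtain ⟨μ, hμ⟩ := exists_linearMap_extends lam
  obtain ⟨B, hB_ne, hB_even, hB⟩ := exists_even_mul_expand_diffFunctional_eq_zero hp hμ
    (map_labelOp_of_labelSeries_eq hμ hG) h_fin
  have h_even : IsEvenSeries (genSeries Γ * twoSinhHalf) := by
    rw [IsEvenSeries, map_mul, hG_odd, rescale_neg_one_twoSinhHalf, neg_mul_neg]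
  exact ⟨genSeries Γ, isQuasipolynomial_genSeries_mul_twoSinhHalf h_even hB_ne hB_even hB,
    h_even, hG⟩

end CircleOp

theorem mainTheorem2 (p : ℂ[X]) (hp : p ≠ 0) (c : ℂ) (hc : CircleOp.IsSymmetricAbout p c)
    (s : ℤˣ) (lam : Module.Dual ℂ (CircleOp.grading p c s hc 0)) :
    CircleOp.IsQuasifinite (CircleOp.grading p c s hc) lam ↔
      ∃ φ : PowerSeries ℂ, CircleOp.IsQuasipolynomial φ ∧ CircleOp.IsEvenSeries φ ∧
        PowerSeries.constantCoeff φ = 0 ∧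
        ∃ G : PowerSeries ℂ, G * CircleOp.twoSinhHalf = φ ∧
          CircleOp.labelSeries p c s hc lam = CircleOp.shiftedOp p c G := by
  constructor
  · intro h_fin
    obtain ⟨G, hG_quasi, hG_even, hG⟩ := CircleOp.exists_quasipolynomial_of_isQuasifinite hp h_fin
    have hG_zero : PowerSeries.constantCoeff (G * CircleOp.twoSinhHalf) = 0 := by
      rw [map_mul, CircleOp.constantCoeff_twoSinhHalf, mul_zero]
    exact ⟨_, hG_quasi, hG_even, hG_zero, G, rfl, hG⟩
  · rintro ⟨_, hG_quasi, -, -, G, rfl, hG⟩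
    exact CircleOp.isQuasifinite_of_labelSeries hp hG_quasi hG
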